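/- Let $d\in\mathbb N$, let $\mathfrak e^1,\dots,\mathfrak e^d$ be a basis of $\mathbb R^d$, let $\Gamma=\mathbb Z\mathfrak e^1+\dots+\mathbb Z\mathfrak e^d$ be the lattice it generates, and let $\Gamma'=\{\gamma'\in\mathbb R^d : \gamma'\cdot\gamma\in 2\pi\mathbb Z\ \text{for all}\ \gamma\in\Gamma\}$ be the dual lattice. Put $\mathbb T_\Gamma=\mathbb R^d/\Gamma$ and $\mathbb B_\Gamma=\mathbb R^d/\Gamma'$ with the quotient topologies. Let $\mathbb W_0$ be the Weyl $*$-algebra, i.e. the complex $*$-algebra with linear basis $\{u_\alpha v_\beta : \alpha,\beta\in\mathbb R^d\}$ and the relations $u_\alpha v_\beta=e^{i\alpha\cdot\beta}v_\beta u_\alpha$, $u_\alpha u_{\alpha'}=u_{\alpha+\alpha'}$, $v_\beta v_{\beta'}=v_{\beta+\beta'}$, $u_\alpha^*=u_{-\alpha}$, $v_\beta^*=v_{-\beta}$. Let $\mathbb W$ be the Weyl $C^*$-algebra, the completion of $\mathbb W_0$ in the norm $\|a\|=\sup_\rho\|\rho(a)\|$, the supremum being over all $*$-representations $\rho$ of $\mathbb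 W_0$ by bounded operators on Hilbert spaces. Set $\tau_\lambda(a)=v_\lambda a v_\lambda^*$ and $\theta_\alpha(a)=u_\alpha a u_\alpha^*$ for $a\in\mathbb W$. States of $\mathbb W$ are the positive normalized linear functionals, with the weak-$*$ topology; pure states are the extreme points of the state space. A state $\omega$ is a Zak state if $\omega\circ\tau_\gamma\circ\theta_{\gamma'}=\omega$ for all $(\gamma,\gamma')\in\Gamma\times\Gamma'$. Let $\mathcal P^{\mathrm Z}_{\mathbb W}$ be the set of pure states that are Zak states, with the induced topology. Then for every $([\kappa],[\nu])\in\mathbb B_\Gamma\times\mathbb T_\Gamma$ there is exactly one state $\omega_{(\kappa,\nu)}$ of $\mathbb W$ such that $$\omega_{(\kappa,\nu)}(u_\alpha v_\beta)=\chi_{\Gamma'}(\alpha)\,\chi_\Gamma(\beta)\,e^{-i\kappa\cdot\beta}\,e^{-i\alpha\cdot\nu}\qquad\text{for all }\alpha,\beta\in\mathbb R^d,$$ where $\chi_{\Gamma'}$ and $\chi_\Gamma$ are the characteristic functions of $\Gamma'$ and $\Gamma$. This state is a pure Zak state, every pure Zak state is of this form, and the map $([\kappa],[\nu])\mapsto\omega_{(\kappa,\nu)}$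 is a homeomorphism from $\mathbb B_\Gamma\times\mathbb T_\Gamma$ onto $\mathcal P^{\mathrm Z}_{\mathbb W}$. Moreover $\mathbb B_\Gamma\times\mathbb T_\Gamma$ is homeomorphic to the $2d$-dimensional torus $(S^1)^{2d}$. -/

import Mathlib

/-- Position (or momentum) space `ℝᵈ` with its Euclidean inner product. -/
abbrev RSpace (d : ℕ) : Type := EuclideanSpace ℝ (Fin d)

/-- The character `exp (i t)` for real `t`. -/
noncomputable def phase (t : ℝ) : ℂ := Complex.exp (Complex.I * (t : ℂ))

theorem phase_add (s t : ℝ) : phase (s + t) = phase s * phase t := by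
  simp [phase, mul_add, Complex.exp_add]

theorem phase_zero : phase 0 = 1 := by simp [phase]

theorem star_phase (t : ℝ) : star (phase t) = phase (-t) := by
  simp [phase, ← Complex.exp_conj]

/-- The Weyl `*`-algebra `𝕎₀`: formal complex linear combinations of the monomials `u_α v_β`.
The basis vector with index `(α, β)` is the monomial `u_α v_β`. -/
def WeylAlg (d : ℕ) : Type := (RSpace d × RSpace d) →₀ ℂ

namespace WeylAlg

variable {d : ℕ}

noncomputable instance : AddCommGroup (WeylAlg d) :=
  inferInstanceAs (AddCommGroup ((RSpace d × RSpace d) →₀ ℂ))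

noncomputable instance : Module ℂ (WeylAlg d) :=
  inferInstanceAs (Module ℂ ((RSpace d × RSpace d) →₀ ℂ))

/-- The scalar multiple `a • u_α v_β` of a monomial, with `p = (α, β)`. -/
noncomputable def mono (p : RSpace d × RSpace d) (a : ℂ) : WeylAlg d := Finsupp.single p a

theorem mono_add (p : RSpace d × RSpace d) (a b : ℂ) :
    mono p (a + b) = mono p a + mono p b := Finsupp.single_add p a b

theorem mono_zero (p : RSpace d × RSpace d) : mono p 0 = 0 := Finsupp.single_zero p

theorem smul_mono (c : ℂ) (p : RSpace d × RSpace d) (a : ℂ) :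
    c • mono p a = mono p (c * a) := Finsupp.smul_single c p a

theorem induction_mono {P : WeylAlg d → Prop} (f : WeylAlg d) (h0 : P 0)
    (hadd : ∀ f g, P f → P g → P (f + g)) (hmono : ∀ p a, P (mono p a)) : P f :=
  Finsupp.induction_linear f h0 hadd hmono

/-- Linear extension of a map given on the monomials `u_α v_β`. -/
noncomputable def lift {M : Type} [AddCommGroup M] [Module ℂ M]
    (φ : RSpace d × RSpace d → M) : WeylAlg d →ₗ[ℂ] M :=
  (Finsupp.linearCombination ℂ φ).comp (LinearMap.id : WeylAlg d →ₗ[ℂ] _ →₀ ℂ)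

theorem lift_mono {M : Type} [AddCommGroup M] [Module ℂ M] (φ : RSpace d × RSpace d → M)
    (p : RSpace d × RSpace d) (a : ℂ) : lift φ (mono p a) = a • φ p :=
  Finsupp.linearCombination_single ℂ a p

/-- The product, determined by
`(u_α v_β) (u_α' v_β') = exp (-i α'·β) u_(α+α') v_(β+β')`, which is what the relations
`u_α v_β = exp (i α·β) v_β u_α`, `u_α u_α' = u_(α+α')`, `v_β v_β' = v_(β+β')` dictate. -/
noncomputable def mulLin : WeylAlg d →ₗ[ℂ] WeylAlg d →ₗ[ℂ] WeylAlg d :=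
  lift fun p => lift fun q => mono (p + q) (phase (-(inner ℝ q.1 p.2)))

/-- The involution, conjugate-linear and determined by
`(u_α v_β)^* = v_(-β) u_(-α) = exp (-i α·β) u_(-α) v_(-β)`. -/
noncomputable def starHom : WeylAlg d →+ WeylAlg d :=
  (Finsupp.liftAddHom fun p : RSpace d × RSpace d =>
    AddMonoidHom.mk' (fun a : ℂ => mono (-p) (star a * phase (-(inner ℝ p.1 p.2))))
      fun a b => by rw [star_add, add_mul, mono_add]).comp
    (AddMonoidHom.id _ : WeylAlg d →+ _ →₀ ℂ)

noncomputable instance : Mul (WeylAlg d) := ⟨fun f g => mulLin f g⟩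
noncomputable instance : One (WeylAlg d) := ⟨mono 0 1⟩
noncomputable instance : Star (WeylAlg d) := ⟨starHom⟩

theorem one_def : (1 : WeylAlg d) = mono 0 1 := rfl

theorem mul_def (f g : WeylAlg d) : f * g = mulLin f g := rfl

theorem mono_mul_mono (p q : RSpace d × RSpace d) (a b : ℂ) :
    mono p a * mono q b = mono (p + q) (a * b * phase (-(inner ℝ q.1 p.2))) := by
  rw [mul_def, mulLin, lift_mono, LinearMap.smul_apply, lift_mono, smul_mono, smul_mono, mul_assoc]

theorem star_mono (p : RSpace d × RSpace d) (a : ℂ) :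
    star (mono p a) = mono (-p) (star a * phase (-(inner ℝ p.1 p.2))) :=
  Finsupp.liftAddHom_apply_single _ p a

protected theorem add_mul' (f g h : WeylAlg d) : (f + g) * h = f * h + g * h := by
  simp only [mul_def, map_add, LinearMap.add_apply]

protected theorem mul_add' (f g h : WeylAlg d) : f * (g + h) = f * g + f * h := by
  simp only [mul_def, map_add]

protected theorem star_add' (f g : WeylAlg d) : star (f + g) = star f + star g :=
  map_add starHom f g

protected theorem zero_mul' (f : WeylAlg d) : 0 * f = 0 := by
  simp only [mul_def, map_zero, LinearMap.zero_apply]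

protected theorem mul_zero' (f : WeylAlg d) : f * 0 = 0 := by
  simp only [mul_def, map_zero]

protected theorem star_zero' : star (0 : WeylAlg d) = 0 := map_zero starHom

protected theorem smul_mul' (c : ℂ) (f g : WeylAlg d) : (c • f) * g = c • (f * g) := by
  simp only [mul_def, map_smul, LinearMap.smul_apply]

protected theorem mul_smul' (c : ℂ) (f g : WeylAlg d) : f * (c • g) = c • (f * g) := by
  simp only [mul_def, map_smul]

protected theorem mul_assoc' (f g h : WeylAlg d) : f * g * h = f * (g * h) := by
  induction f using induction_mono with
  | h0 => simp [WeylAlg.zero_mul']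
  | hadd f f' e e' => simp only [WeylAlg.add_mul', e, e']
  | hmono p a =>
    induction g using induction_mono with
    | h0 => simp [WeylAlg.zero_mul', WeylAlg.mul_zero']
    | hadd f f' e e' => simp only [WeylAlg.add_mul', WeylAlg.mul_add', e, e']
    | hmono q b =>
      induction h using induction_mono with
      | h0 => simp [WeylAlg.mul_zero']
      | hadd f f' e e' => simp only [WeylAlg.mul_add', e, e']
      | hmono r c =>
        simp only [mono_mul_mono, add_assoc]
        congr 1
        simp only [Prod.fst_add, Prod.snd_add, inner_add_left, inner_add_right, neg_add,
          phase_add]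
        ring

protected theorem one_mul' (f : WeylAlg d) : 1 * f = f := by
  induction f using induction_mono with
  | h0 => exact WeylAlg.mul_zero' _
  | hadd f f' e e' => simp only [WeylAlg.mul_add', e, e']
  | hmono p a => simp [one_def, mono_mul_mono, phase_zero]

protected theorem mul_one' (f : WeylAlg d) : f * 1 = f := by
  induction f using induction_mono with
  | h0 => exact WeylAlg.zero_mul' _
  | hadd f f' e e' => simp only [WeylAlg.add_mul', e, e']
  | hmono p a => simp [one_def, mono_mul_mono, phase_zero]

noncomputable instance : Ring (WeylAlg d) where
  __ := (inferInstance : AddCommGroup (WeylAlg d))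
  mul := (· * ·)
  one := 1
  left_distrib := WeylAlg.mul_add'
  right_distrib := WeylAlg.add_mul'
  zero_mul := WeylAlg.zero_mul'
  mul_zero := WeylAlg.mul_zero'
  mul_assoc := WeylAlg.mul_assoc'
  one_mul := WeylAlg.one_mul'
  mul_one := WeylAlg.mul_one'

noncomputable instance : Algebra ℂ (WeylAlg d) :=
  Algebra.ofModule WeylAlg.smul_mul' WeylAlg.mul_smul'

noncomputable instance : StarRing (WeylAlg d) where
  star_add := WeylAlg.star_add'
  star_involutive f := by
    induction f using induction_mono with
    | h0 => rw [WeylAlg.star_zero', WeylAlg.star_zero']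
    | hadd f f' e e' => simp only [WeylAlg.star_add', e, e']
    | hmono p a =>
      simp only [star_mono, neg_neg, star_mul', star_star, star_phase, Prod.fst_neg, Prod.snd_neg,
        inner_neg_neg]
      rw [mul_assoc, ← phase_add, add_neg_cancel, phase_zero, mul_one]
  star_mul f g := by
    induction f using induction_mono with
    | h0 => simp [WeylAlg.star_zero']
    | hadd f f' e e' => simp only [WeylAlg.star_add', add_mul, mul_add, e, e']
    | hmono p a =>
      induction g using induction_mono with
      | h0 => simp [WeylAlg.star_zero']
      | hadd f f' e e' => simp only [WeylAlg.star_add', mul_add, add_mul, e, e']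
      | hmono q b =>
        simp only [star_mono, mono_mul_mono, star_mul', star_phase, neg_neg, neg_add_rev,
          Prod.fst_neg, Prod.snd_neg, Prod.fst_add, Prod.snd_add, inner_neg_neg, inner_add_left,
          inner_add_right, phase_add]
        congr 1
        have h : phase (inner ℝ q.1 p.2) * phase (-(inner ℝ q.1 p.2)) = 1 := by
          rw [← phase_add, add_neg_cancel, phase_zero]
        linear_combination (star a * star b * phase (-(inner ℝ q.1 q.2)) *
          phase (-(inner ℝ p.1 q.2)) * phase (-(inner ℝ p.1 p.2))) * h

instance : StarModule ℂ (WeylAlg d) where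
  star_smul c f := by
    induction f using induction_mono with
    | h0 => simp
    | hadd f f' e e' => simp only [smul_add, star_add, e, e']
    | hmono p a => simp only [smul_mono, star_mono, star_mul', mul_assoc]

end WeylAlg

/-- A `*`-representation of `𝕎₀` by bounded operators on a Hilbert space. Since `𝕎₀` has the
cardinality of the continuum, every cyclic representation is equivalent to one in `Type`, so that
this universe suffices for the supremum of the operator norms over all representations. -/
structure WeylRep (d : ℕ) : Type 1 where
  /-- the Hilbert space -/
  H : Type
  [normedAddCommGroup : NormedAddCommGroup H]
  [innerProductSpace : InnerProductSpace ℂ H]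
  [completeSpace : CompleteSpace H]
  /-- the representation -/
  rho : WeylAlg d →⋆ₐ[ℂ] (H →L[ℂ] H)

attribute [instance] WeylRep.normedAddCommGroup WeylRep.innerProductSpace WeylRep.completeSpace

namespace WeylAlg

variable {d : ℕ}

/-- The minimal regular norm: `‖a‖ = sup_ρ ‖ρ(a)‖` over all `*`-representations `ρ` of `𝕎₀`. -/
noncomputable instance : Norm (WeylAlg d) := ⟨fun a => ⨆ π : WeylRep d, ‖π.rho a‖⟩

theorem norm_def (a : WeylAlg d) : ‖a‖ = ⨆ π : WeylRep d, ‖π.rho a‖ := rfl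

theorem star_mono_mul_self (p : RSpace d × RSpace d) :
    star (mono p 1) * mono p 1 = (1 : WeylAlg d) := by
  rw [star_mono, mono_mul_mono, one_def]
  simp only [neg_add_cancel, star_one, one_mul, mul_one, Prod.snd_neg, inner_neg_right, neg_neg]
  rw [← phase_add, neg_add_cancel, phase_zero]

theorem bddAbove_rep (a : WeylAlg d) : BddAbove (Set.range fun π : WeylRep d => ‖π.rho a‖) := by
  suffices h : ∃ C : ℝ, ∀ π : WeylRep d, ‖π.rho a‖ ≤ C by
    obtain ⟨C, hC⟩ := h
    exact ⟨C, by rintro _ ⟨π, rfl⟩; exact hC π⟩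
  induction a using induction_mono with
  | h0 => exact ⟨0, fun π => by simp⟩
  | hadd f g hf hg =>
    obtain ⟨C, hC⟩ := hf
    obtain ⟨D, hD⟩ := hg
    refine ⟨C + D, fun π => ?_⟩
    rw [map_add]
    exact (norm_add_le _ _).trans (add_le_add (hC π) (hD π))
  | hmono p a =>
    refine ⟨‖a‖, fun π => ?_⟩
    have h1 : ‖π.rho (mono p 1)‖ ≤ 1 := by
      have h := CStarRing.norm_star_mul_self (x := π.rho (mono p 1))
      rw [← map_star, ← map_mul, star_mono_mul_self, map_one] at h
      have h2 : ‖(1 : π.H →L[ℂ] π.H)‖ ≤ 1 := ContinuousLinearMap.norm_id_le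
      nlinarith [norm_nonneg (π.rho (mono p 1))]
    have h3 : mono p a = a • mono p 1 := by rw [smul_mono, mul_one]
    rw [h3, map_smul, norm_smul]
    exact mul_le_of_le_one_right (norm_nonneg a) h1

/-- The zero representation shows that there is at least one representation. -/
noncomputable instance : Nonempty (WeylRep d) :=
  ⟨{ H := EuclideanSpace ℂ (Fin 0)
     rho :=
      { toFun := fun _ => 0
        map_one' := Subsingleton.elim _ _
        map_mul' := fun _ _ => Subsingleton.elim _ _
        map_zero' := rfl
        map_add' := fun _ _ => Subsingleton.elim _ _
        commutes' := fun _ => Subsingleton.elim _ _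
        map_star' := fun _ => Subsingleton.elim _ _ } }⟩

theorem le_norm (π : WeylRep d) (a : WeylAlg d) : ‖π.rho a‖ ≤ ‖a‖ :=
  le_ciSup (bddAbove_rep a) π

theorem norm_nonneg' (a : WeylAlg d) : 0 ≤ ‖a‖ := Real.iSup_nonneg fun _ => norm_nonneg _

noncomputable instance : SeminormedRing (WeylAlg d) where
  __ := (inferInstance : Ring (WeylAlg d))
  __ := AddGroupSeminorm.toSeminormedAddCommGroup (E := WeylAlg d)
    { toFun := fun a => ‖a‖
      map_zero' := by simp [norm_def]
      add_le' := fun a b => ciSup_le fun π => by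
        rw [map_add]
        exact (norm_add_le _ _).trans (add_le_add (le_norm π a) (le_norm π b))
      neg' := fun a => by simp [norm_def] }
  norm_mul_le a b := ciSup_le fun π => by
    rw [map_mul]
    exact (norm_mul_le _ _).trans
      (mul_le_mul (le_norm π a) (le_norm π b) (norm_nonneg _) (norm_nonneg' a))

noncomputable instance : NormedAlgebra ℂ (WeylAlg d) where
  norm_smul_le c a := ciSup_le fun π => by
    rw [map_smul, norm_smul]
    exact mul_le_mul_of_nonneg_left (le_norm π a) (norm_nonneg c)

theorem norm_star_eq (a : WeylAlg d) : ‖star a‖ = ‖a‖ := by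
  simp [norm_def, map_star]

theorem norm_sq_le_star_mul (a : WeylAlg d) : ‖a‖ * ‖a‖ ≤ ‖star a * a‖ := by
  have h : ‖a‖ ≤ Real.sqrt ‖star a * a‖ := ciSup_le fun π => by
    apply Real.le_sqrt_of_sq_le
    have h := CStarRing.norm_star_mul_self (x := π.rho a)
    rw [← map_star, ← map_mul] at h
    rw [pow_two, ← h]
    exact le_norm π _
  calc ‖a‖ * ‖a‖ ≤ Real.sqrt ‖star a * a‖ * Real.sqrt ‖star a * a‖ :=
        mul_self_le_mul_self (norm_nonneg' a) h
    _ = ‖star a * a‖ := Real.mul_self_sqrt (norm_nonneg' _)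

theorem isometry_star : Isometry (star : WeylAlg d → WeylAlg d) :=
  AddMonoidHomClass.isometry_of_norm (starAddEquiv : WeylAlg d ≃+ WeylAlg d) norm_star_eq

end WeylAlg

/-- The Weyl `C*`-algebra `𝕎`: the completion of `𝕎₀` in the minimal regular norm. -/
abbrev WeylCStar (d : ℕ) : Type := UniformSpace.Completion (WeylAlg d)

namespace WeylCStar

open UniformSpace

variable {d : ℕ}

/-- The involution of `𝕎` is the continuous extension of the involution of `𝕎₀`. -/
noncomputable instance : Star (WeylCStar d) :=
  ⟨Completion.map (star : WeylAlg d → WeylAlg d)⟩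

theorem coe_star (a : WeylAlg d) : ((star a : WeylAlg d) : WeylCStar d) = star (a : WeylCStar d) :=
  (Completion.map_coe WeylAlg.isometry_star.uniformContinuous a).symm

theorem continuous_star' : Continuous (star : WeylCStar d → WeylCStar d) :=
  Completion.continuous_map

noncomputable instance : StarRing (WeylCStar d) where
  star_involutive a := by
    induction a using Completion.induction_on with
    | hp => exact isClosed_eq (continuous_star'.comp continuous_star') continuous_id
    | ih a => rw [← coe_star, ← coe_star, star_star]
  star_mul a b := by
    induction a, b using Completion.induction_on₂ with
    | hp =>
      exact isClosed_eq (continuous_star'.comp continuous_mul)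
        ((continuous_star'.comp continuous_snd).mul (continuous_star'.comp continuous_fst))
    | ih a b =>
      rw [← Completion.coe_mul, ← coe_star, star_mul, Completion.coe_mul, coe_star, coe_star]
  star_add a b := by
    induction a, b using Completion.induction_on₂ with
    | hp =>
      exact isClosed_eq (continuous_star'.comp continuous_add)
        ((continuous_star'.comp continuous_fst).add (continuous_star'.comp continuous_snd))
    | ih a b =>
      rw [← Completion.coe_add, ← coe_star, star_add, Completion.coe_add, coe_star, coe_star]

noncomputable instance : CStarAlgebra (WeylCStar d) where
  norm_smul_le c a := norm_smul_le c a
  star_smul c a := by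
    induction a using Completion.induction_on with
    | hp =>
      exact isClosed_eq (continuous_star'.comp (continuous_const_smul c))
        (continuous_star'.const_smul (star c))
    | ih a =>
      rw [← Completion.coe_smul, ← coe_star, star_smul, Completion.coe_smul, coe_star]
  norm_mul_self_le a := by
    induction a using Completion.induction_on with
    | hp =>
      exact isClosed_le (continuous_norm.mul continuous_norm)
        (continuous_norm.comp (continuous_star'.mul continuous_id))
    | ih a =>
      rw [← coe_star, ← Completion.coe_mul, Completion.norm_coe, Completion.norm_coe]
      exact WeylAlg.norm_sq_le_star_mul a

/-- The generator `u_α` of `𝕎`. -/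
noncomputable def u (α : RSpace d) : WeylCStar d := (WeylAlg.mono (α, 0) 1 : WeylAlg d)

/-- The generator `v_β` of `𝕎`. -/
noncomputable def v (β : RSpace d) : WeylCStar d := (WeylAlg.mono (0, β) 1 : WeylAlg d)

/-- The space translation `τ_lam (a) = v_lam a v_lam^*`. -/
noncomputable def tau (lam : RSpace d) (a : WeylCStar d) : WeylCStar d := v lam * a * star (v lam)

/-- The momentum translation `θ_α (a) = u_α a u_α^*`. -/
noncomputable def theta (α : RSpace d) (a : WeylCStar d) : WeylCStar d := u α * a * star (u α)

open scoped ComplexOrder in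
/-- The state space of `𝕎`: positive normalized linear functionals, inside the topological dual
with the weak-`*` topology (positive functionals on a unital `C*`-algebra are automatically
continuous). -/
def stateSpace (d : ℕ) : Set (WeakDual ℂ (WeylCStar d)) :=
  {ω | (∀ a : WeylCStar d, 0 ≤ ω (star a * a)) ∧ ω 1 = 1}

/-- The pure states: the extreme points of the state space. -/
def pureStates (d : ℕ) : Set (WeakDual ℂ (WeylCStar d)) :=
  Set.extremePoints ℝ (stateSpace d)

end WeylCStar

/-- The lattice of integer combinations of the vectors of a basis of `ℝᵈ`. -/
def latticeOf {d : ℕ} (e : Module.Basis (Fin d) ℝ (RSpace d)) : AddSubgroup (RSpace d) :=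
  AddSubgroup.closure (Set.range e)

/-- The dual lattice `Γ' = {γ' | γ'·γ ∈ 2πℤ for all γ ∈ Γ}`. -/
def dualLattice {d : ℕ} (Γ : AddSubgroup (RSpace d)) : AddSubgroup (RSpace d) where
  carrier := {γ' | ∀ γ ∈ Γ, ∃ n : ℤ, inner ℝ γ' γ = 2 * Real.pi * n}
  zero_mem' := fun γ _ => ⟨0, by simp⟩
  add_mem' := by
    intro x y hx hy γ hγ
    obtain ⟨m, hm⟩ := hx γ hγ
    obtain ⟨n, hn⟩ := hy γ hγ
    exact ⟨m + n, by rw [inner_add_left, hm, hn]; push_cast; ring⟩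
  neg_mem' := by
    intro x hx γ hγ
    obtain ⟨m, hm⟩ := hx γ hγ
    exact ⟨-m, by rw [inner_neg_left, hm]; push_cast; ring⟩

/-- The torus `𝕋_Γ = ℝᵈ/Γ`, with the quotient topology. -/
abbrev LatticeTorus {d : ℕ} (Γ : AddSubgroup (RSpace d)) : Type := RSpace d ⧸ Γ

/-- The Brillouin zone `𝔹_Γ = ℝᵈ/Γ'`, with the quotient topology. -/
abbrev BrillouinZone {d : ℕ} (Γ : AddSubgroup (RSpace d)) : Type := RSpace d ⧸ dualLattice Γ

/-- The Zak states: `ω ∘ τ_γ ∘ θ_γ' = ω` for all `(γ, γ') ∈ Γ × Γ'`. -/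
def zakStates {d : ℕ} (Γ : AddSubgroup (RSpace d)) : Set (WeakDual ℂ (WeylCStar d)) :=
  {ω | ω ∈ WeylCStar.stateSpace d ∧ ∀ γ ∈ Γ, ∀ γ' ∈ dualLattice Γ, ∀ a : WeylCStar d,
    ω (WeylCStar.tau γ (WeylCStar.theta γ' a)) = ω a}

/-- The pure Zak states, with the weak-`*` topology. -/
def pureZakStates {d : ℕ} (Γ : AddSubgroup (RSpace d)) : Set (WeakDual ℂ (WeylCStar d)) :=
  zakStates Γ ∩ WeylCStar.pureStates d

open scoped Classical in
/-- The value `χ_Γ'(α) χ_Γ(β) exp (-i κ·β) exp (-i α·ν)`. -/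
noncomputable def zakValue {d : ℕ} (Γ : AddSubgroup (RSpace d)) (κ ν α β : RSpace d) : ℂ :=
  (if α ∈ dualLattice Γ then 1 else 0) * (if β ∈ Γ then 1 else 0) *
    phase (-(inner ℝ κ β)) * phase (-(inner ℝ α ν))

/-! For `γ' ∈ Γ'` and `γ ∈ Γ` the commutation phase `exp (i γ'·γ)` is 1, so the lattice unitaries `u
γ'` and `v γ` commute, and a pure state invariant under conjugation by them should restrict to a
character of `Γ' × Γ`. The pairs `(κ, ν)` modulo `Γ' × Γ` parametrize these characters.

Rigidity (`eq_zakValue_of_lattice_values`): by Cauchy–Schwarz, a state of modulus one on a unitary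
`U` is multiplicative in products with `U`. If this holds for all lattice unitaries, moving one of
them past `u α * v β` costs a phase different from 1 unless `(α, β) ∈ Γ' × Γ`, so the state vanishes
off the lattice and is determined by its character.

Purity (`zakState_mem_pureStates`): the components of a convex decomposition have values in the unit
disc, so they agree with the state wherever it has modulus one, and rigidity applies to them.

Converse (`map_unitary_mul_of_pure`): if `ω` is invariant under conjugation by `U`, it is a mixture
of the normalized functionals `a ↦ ω ((1 ± z U) a (1 ± z U)^*)`. Purity makes `ω` multiplicative on
`U`, hence of modulus one there.

Existence (`exists_zakState`): the character is induced to a representation on `ℓ²` of phase space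
modulo `Γ' × Γ`, and the vector state at the origin has the required values. The parametrization is
then a continuous bijection from a compact space to a Hausdorff one. -/

theorem phase_eq_one_iff (t : ℝ) : phase t = 1 ↔ ∃ n : ℤ, t = 2 * Real.pi * n := by
  rw [phase, Complex.exp_eq_one_iff]
  refine exists_congr fun n => ?_
  rw [show (n : ℂ) * (2 * Real.pi * Complex.I) = Complex.I * ((2 * Real.pi * n : ℝ) : ℂ) by
    push_cast; ring, mul_right_inj' Complex.I_ne_zero, Complex.ofReal_inj]

theorem norm_phase (t : ℝ) : ‖phase t‖ = 1 := by
  rw [phase, mul_comm]; exact Complex.norm_exp_ofReal_mul_I t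

theorem phase_ne_zero (t : ℝ) : phase t ≠ 0 := Complex.exp_ne_zero _

theorem phase_neg_mul_phase (t : ℝ) : phase (-t) * phase t = 1 := by
  rw [← phase_add, neg_add_cancel, phase_zero]

theorem phase_mul_phase_neg (t : ℝ) : phase t * phase (-t) = 1 := by
  rw [← phase_add, add_neg_cancel, phase_zero]

theorem exists_phase_eq {z : ℂ} (hz : ‖z‖ = 1) : ∃ t : ℝ, phase t = z := by
  refine ⟨z.arg, ?_⟩
  have h := Complex.norm_mul_exp_arg_mul_I z
  rw [hz, Complex.ofReal_one, one_mul, mul_comm] at h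
  exact h

@[fun_prop]
theorem continuous_phase : Continuous phase := by unfold phase; fun_prop

/-! ### Lattices, dual lattices, their characters and their tori. -/

section Lattice

variable {d : ℕ} (e : Module.Basis (Fin d) ℝ (RSpace d))

theorem mem_latticeOf_iff (x : RSpace d) :
    x ∈ latticeOf e ↔ ∀ i, ∃ n : ℤ, e.repr x i = n := by
  rw [latticeOf, AddSubgroup.mem_closure_range_iff_of_fintype]
  constructor
  · rintro ⟨a, rfl⟩ i
    refine ⟨a i, ?_⟩
    simp [Finsupp.single_apply]
  · intro h
    choose a ha using h
    refine ⟨a, ?_⟩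
    conv_lhs => rw [← e.sum_repr x]
    exact Finset.sum_congr rfl fun i _ => by rw [ha, Int.cast_smul_eq_zsmul]

theorem nondegenerate_innerₗ :
    (innerₗ (RSpace d) : LinearMap.BilinForm ℝ (RSpace d)).Nondegenerate :=
  ⟨fun x h => inner_self_eq_zero.1 (h x), fun x h => inner_self_eq_zero.1 (h x)⟩

/-- The basis of the dual lattice: `e'_i · e_j = 2π δ_ij`. -/
noncomputable def dualLatticeBasis : Module.Basis (Fin d) ℝ (RSpace d) :=
  (LinearMap.BilinForm.dualBasis (innerₗ (RSpace d)) nondegenerate_innerₗ e).unitsSMul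
    fun _ => Units.mk0 (2 * Real.pi) (by positivity)

theorem inner_dualLatticeBasis_basis (i j : Fin d) :
    inner ℝ (dualLatticeBasis e i) (e j) = if j = i then 2 * Real.pi else 0 := by
  have h := LinearMap.BilinForm.apply_dualBasis_left (B := innerₗ (RSpace d))
    nondegenerate_innerₗ e i j
  rw [dualLatticeBasis, Module.Basis.unitsSMul_apply, Units.smul_mk0, inner_smul_left]
  rw [innerₗ_apply_apply] at h
  simp [h]

theorem inner_basis_right (x : RSpace d) (j : Fin d) :
    inner ℝ x (e j) = 2 * Real.pi * (dualLatticeBasis e).repr x j := by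
  conv_lhs => rw [← (dualLatticeBasis e).sum_repr x]
  simp [-Module.Basis.sum_repr, sum_inner, inner_smul_left, inner_dualLatticeBasis_basis, mul_comm]

theorem inner_dualLatticeBasis_left (x : RSpace d) (i : Fin d) :
    inner ℝ (dualLatticeBasis e i) x = 2 * Real.pi * e.repr x i := by
  conv_lhs => rw [← e.sum_repr x]
  simp [-Module.Basis.sum_repr, inner_sum, inner_smul_right, inner_dualLatticeBasis_basis, mul_comm]

theorem mem_dualLattice_iff_basis (x : RSpace d) :
    x ∈ dualLattice (latticeOf e) ↔ ∀ j, ∃ n : ℤ, inner ℝ x (e j) = 2 * Real.pi * n := by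
  constructor
  · exact fun h j => h _ (AddSubgroup.subset_closure ⟨j, rfl⟩)
  · intro h γ hγ
    induction hγ using AddSubgroup.closure_induction with
    | mem y hy => obtain ⟨j, rfl⟩ := hy; exact h j
    | zero => exact ⟨0, by simp⟩
    | add y z _ _ hy hz =>
      obtain ⟨m, hm⟩ := hy
      obtain ⟨n, hn⟩ := hz
      exact ⟨m + n, by rw [inner_add_right, hm, hn]; push_cast; ring⟩
    | neg y _ hy =>
      obtain ⟨m, hm⟩ := hy
      exact ⟨-m, by rw [inner_neg_right, hm]; push_cast; ring⟩

/-- This gives `Γ'` a basis, so that everything proved for `latticeOf` (characters, torus quotient)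
applies to it too. -/
theorem dualLattice_latticeOf :
    dualLattice (latticeOf e) = latticeOf (dualLatticeBasis e) := by
  ext x
  rw [mem_dualLattice_iff_basis, mem_latticeOf_iff]
  refine forall_congr' fun j => exists_congr fun n => ?_
  rw [inner_basis_right, mul_right_inj' (by positivity)]

theorem dualLatticeBasis_mem (i : Fin d) : dualLatticeBasis e i ∈ dualLattice (latticeOf e) := by
  rw [dualLattice_latticeOf]
  exact AddSubgroup.subset_closure ⟨i, rfl⟩

/-- The double dual of a lattice is the lattice. -/
theorem mem_latticeOf_of_inner {x : RSpace d}
    (h : ∀ γ' ∈ dualLattice (latticeOf e), ∃ n : ℤ, inner ℝ γ' x = 2 * Real.pi * n) :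
    x ∈ latticeOf e := by
  rw [mem_latticeOf_iff]
  intro i
  obtain ⟨n, hn⟩ := h _ (dualLatticeBasis_mem e i)
  rw [inner_dualLatticeBasis_left, mul_right_inj' (by positivity)] at hn
  exact ⟨n, hn⟩

theorem phase_inner_eq_one {Γ : AddSubgroup (RSpace d)} {γ γ' : RSpace d}
    (h' : γ' ∈ dualLattice Γ) (h : γ ∈ Γ) : phase (inner ℝ γ' γ) = 1 :=
  (phase_eq_one_iff _).2 (h' γ h)

/-- A unitary character of a lattice is the restriction of `x ↦ exp (i k·x)`. -/
theorem exists_phase_inner_eq (c : RSpace d → ℂ)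
    (hc : ∀ x ∈ latticeOf e, ‖c x‖ = 1)
    (hadd : ∀ x ∈ latticeOf e, ∀ y ∈ latticeOf e, c (x + y) = c x * c y) :
    ∃ k : RSpace d, ∀ x ∈ latticeOf e, c x = phase (inner ℝ k x) := by
  have hmem : ∀ j, e j ∈ latticeOf e := fun j => AddSubgroup.subset_closure ⟨j, rfl⟩
  choose t ht using fun j => exists_phase_eq (hc (e j) (hmem j))
  -- The coefficients make the inner product of this vector with `e j` equal to `t j`, an argument
  -- of `c (e j)`.
  refine ⟨∑ i, ((2 * Real.pi)⁻¹ * t i) • dualLatticeBasis e i, fun x hx => ?_⟩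
  have h0 : c 0 = 1 := by
    have h := hadd 0 (zero_mem _) 0 (zero_mem _)
    have h1 : c 0 ≠ 0 := fun h0 => by simpa [h0] using hc 0 (zero_mem _)
    rw [add_zero] at h
    exact (mul_eq_left₀ h1).1 h.symm
  induction hx using AddSubgroup.closure_induction with
  | mem y hy =>
    obtain ⟨j, rfl⟩ := hy
    rw [← ht j]
    congr 1
    rw [inner_basis_right]
    have : (2 * Real.pi) ≠ 0 := by positivity
    simp only [map_sum, map_smul, Module.Basis.repr_self, Finsupp.smul_single, smul_eq_mul, mul_one,
      Finsupp.coe_finsetSum, Finset.sum_apply, Finsupp.single_apply, Finset.sum_ite_eq',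
      Finset.mem_univ, if_true]
    rw [mul_inv_cancel_left₀ this]
  | zero => rw [h0, inner_zero_right, phase_zero]
  | add y z hy hz ihy ihz => rw [hadd y hy z hz, ihy, ihz, inner_add_right, phase_add]
  | neg y hy ihy =>
    have h1 := hadd y hy (-y) (neg_mem hy)
    rw [add_neg_cancel, h0, ihy] at h1
    rw [inner_neg_right]
    refine mul_left_cancel₀ (phase_ne_zero (inner ℝ _ y)) (h1.symm.trans ?_)
    rw [phase_mul_phase_neg]

/-- The coordinates with respect to `e`, modulo the integers. -/
noncomputable def toTorus : RSpace d → (Fin d → AddCircle (1 : ℝ)) :=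
  fun x i => (e.repr x i : ℝ)

/-- A linear homeomorphism followed by a product of quotient maps; openness is what makes such a
product a quotient map again. -/
theorem isOpenQuotientMap_toTorus : IsOpenQuotientMap (toTorus e) := by
  have h1 : IsOpenQuotientMap e.equivFunL :=
    ⟨e.equivFunL.surjective, e.equivFunL.continuous, e.equivFunL.toHomeomorph.isOpenMap⟩
  have h2 : IsOpenQuotientMap (fun (x : Fin d → ℝ) (i : Fin d) => (x i : AddCircle (1 : ℝ))) :=
    IsOpenQuotientMap.piMap fun _ => QuotientAddGroup.isOpenQuotientMap_mk
  exact h2.comp h1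

theorem toTorus_eq_iff (x y : RSpace d) :
    toTorus e x = toTorus e y ↔ (x : RSpace d ⧸ latticeOf e) = y := by
  rw [QuotientAddGroup.eq, mem_latticeOf_iff, funext_iff]
  refine forall_congr' fun i => ?_
  rw [eq_comm, ← sub_eq_zero]
  simp only [toTorus]
  rw [← QuotientAddGroup.mk_sub, AddCircle.coe_eq_zero_iff]
  refine exists_congr fun n => ?_
  simp only [map_add, map_neg, Finsupp.add_apply, Finsupp.neg_apply, zsmul_eq_mul, mul_one]
  constructor <;> intro h <;> linarith

/-- The quotient by a lattice is a torus. -/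
noncomputable def latticeTorusHomeomorph : (RSpace d ⧸ latticeOf e) ≃ₜ (Fin d → Circle) :=
  let f : (RSpace d ⧸ latticeOf e) → (Fin d → AddCircle (1 : ℝ)) :=
    Quotient.lift (toTorus e) fun x y h => (toTorus_eq_iff e x y).2 (Quotient.sound h)
  have hq : IsOpenQuotientMap f :=
    (QuotientAddGroup.isOpenQuotientMap_mk.of_comp_iff (g := f)).1 (isOpenQuotientMap_toTorus e)
  have hinj : Function.Injective f := by
    intro a b
    induction a using Quotient.inductionOn
    induction b using Quotient.inductionOn
    exact (toTorus_eq_iff e _ _).1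
  ((Equiv.ofBijective f ⟨hinj, hq.surjective⟩).toHomeomorphOfContinuousOpen
    hq.continuous hq.isOpenMap).trans
    (Homeomorph.piCongrRight fun _ => AddCircle.homeomorphCircle one_ne_zero)

theorem nonempty_brillouinZone_homeomorph :
    Nonempty (BrillouinZone (latticeOf e) ≃ₜ (Fin d → Circle)) := by
  change Nonempty ((RSpace d ⧸ dualLattice (latticeOf e)) ≃ₜ (Fin d → Circle))
  rw [dualLattice_latticeOf]
  exact ⟨latticeTorusHomeomorph _⟩

instance : CompactSpace (LatticeTorus (latticeOf e)) :=
  (latticeTorusHomeomorph e).symm.compactSpace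

instance : CompactSpace (BrillouinZone (latticeOf e)) :=
  (nonempty_brillouinZone_homeomorph e).some.symm.compactSpace

theorem nonempty_brillouinZone_prod_latticeTorus_homeomorph :
    Nonempty ((BrillouinZone (latticeOf e) × LatticeTorus (latticeOf e)) ≃ₜ
      (Fin (2 * d) → Circle)) := by
  obtain ⟨h⟩ := nonempty_brillouinZone_homeomorph e
  exact ⟨((h.prodCongr (latticeTorusHomeomorph e)).trans (Fin.appendHomeomorph d d)).trans
    (Homeomorph.piCongrLeft (Y := fun _ => Circle) (finCongr (two_mul d).symm))⟩

end Lattice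

/-! ### Cauchy–Schwarz arguments for positive functionals. -/

section PositiveFunctional

open scoped ComplexOrder

variable {A : Type*} [CStarAlgebra A] {f : A →ₗ[ℂ] ℂ}

theorem expand_star_add_smul_mul (f : A →ₗ[ℂ] ℂ) (a b : A) (c : ℂ) :
    f (star (a + c • b) * (a + c • b)) =
      f (star a * a) + c * f (star a * b) + star c * f (star b * a)
        + (star c * c) * f (star b * b) := by
  simp only [star_add, star_smul, add_mul, mul_add, smul_mul_assoc, mul_smul_comm, map_add,
    map_smul, smul_eq_mul]
  ring

/-- Polarization: the expansion of `f (star (a + c • b) * (a + c • b))` is real, and `c = 1`, `c =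
I` yield the imaginary and the real part of the identity. -/
theorem map_star_mul_symm (hf : ∀ a : A, 0 ≤ f (star a * a)) (a b : A) :
    f (star b * a) = star (f (star a * b)) := by
  have h (c : ℂ) := (Complex.nonneg_iff.1 (hf (a + c • b))).2
  have ha := (Complex.nonneg_iff.1 (hf a)).2
  have hb := (Complex.nonneg_iff.1 (hf b)).2
  have h1 := h 1
  have h2 := h Complex.I
  rw [expand_star_add_smul_mul] at h1 h2
  simp [← ha, ← hb] at h1 h2
  apply Complex.ext
  · simp; linarith
  · simp; linarith

theorem map_star_of_nonneg (hf : ∀ a : A, 0 ≤ f (star a * a)) (a : A) :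
    f (star a) = star (f a) := by
  simpa using map_star_mul_symm hf 1 a

/-- The degenerate case of Cauchy–Schwarz: with the quadratic term gone, a real affine function of
`c` stays nonnegative, so its linear part vanishes. -/
theorem map_star_mul_eq_zero (hf : ∀ a : A, 0 ≤ f (star a * a)) {b : A}
    (hb : f (star b * b) = 0) (a : A) : f (star b * a) = 0 := by
  have key (c : ℂ) : 0 ≤ (f (star a * a)).re + 2 * (c * star (f (star b * a))).re := by
    have h := (Complex.nonneg_iff.1 (hf (a + c • b))).1
    rw [expand_star_add_smul_mul, hb, map_star_mul_symm hf b a] at h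
    simp at h ⊢
    linarith
  by_contra hne
  set w := f (star b * a)
  have hpos : 0 < Complex.normSq w := Complex.normSq_pos.2 hne
  set M := (f (star a * a)).re
  -- This `c` turns the right side of `key` into `M - 2 (M + 1)`, which is negative.
  have h := key (((-(M + 1) / Complex.normSq w : ℝ) : ℂ) * w)
  have h1 : ((-(M + 1) / Complex.normSq w : ℝ) : ℂ) * w * star w = ((-(M + 1) : ℝ) : ℂ) := by
    rw [mul_assoc, Complex.star_def, Complex.mul_conj, ← Complex.ofReal_mul,
      div_mul_cancel₀ _ hpos.ne']
  rw [h1, Complex.ofReal_re] at h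
  have hM : 0 ≤ M := (Complex.nonneg_iff.1 (hf a)).1
  linarith

/-- The element `b = star U - star (f U) • 1` satisfies `f (star b * b) = 1 - |f U|² = 0`, so `f`
kills `star b * a = (U - f U) a`. -/
theorem map_mul_of_norm_eq_one_left (hf : ∀ a : A, 0 ≤ f (star a * a)) (h1 : f 1 = 1)
    {U : A} (hU : U * star U = 1) (hn : ‖f U‖ = 1) (a : A) :
    f (U * a) = f U * f a := by
  have hc : f U * star (f U) = 1 := by
    rw [Complex.star_def, Complex.mul_conj, Complex.normSq_eq_norm_sq, hn]; simp
  have h0 : f (star (star U - star (f U) • 1) * (star U - star (f U) • 1)) = 0 := by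
    simp only [star_sub, star_star, star_smul, star_one, sub_mul, mul_sub, hU, map_sub, h1,
      smul_mul_assoc, mul_smul_comm, one_mul, mul_one, map_smul, smul_eq_mul,
      map_star_of_nonneg hf U]
    linear_combination -hc
  have h := map_star_mul_eq_zero hf h0 a
  simp only [star_sub, star_star, star_smul, star_one, sub_mul, smul_mul_assoc, one_mul, map_sub,
    map_smul, smul_eq_mul] at h
  exact sub_eq_zero.1 h

theorem map_mul_of_norm_eq_one_right (hf : ∀ a : A, 0 ≤ f (star a * a)) (h1 : f 1 = 1)
    {U : A} (hU : star U * U = 1) (hn : ‖f U‖ = 1) (a : A) :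
    f (a * U) = f a * f U := by
  have h := map_mul_of_norm_eq_one_left hf h1 (U := star U) (by rw [star_star, hU])
    (by rw [map_star_of_nonneg hf, norm_star, hn]) (star a)
  have h2 := congrArg star h
  rwa [← star_mul, map_star_of_nonneg hf, star_star, map_star_of_nonneg hf,
    map_star_of_nonneg hf, star_mul', star_star, star_star, mul_comm] at h2

/-- Positivity on `1 + U` reads `2 + 2 Re (f U) ≥ 0`. -/
theorem neg_one_le_re_map (hf : ∀ a : A, 0 ≤ f (star a * a)) (h1 : f 1 = 1)
    {U : A} (hU : star U * U = 1) : -1 ≤ (f U).re := by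
  have h := (Complex.nonneg_iff.1 (hf (1 + (1 : ℂ) • U))).1
  rw [expand_star_add_smul_mul, hU] at h
  simp [h1, map_star_of_nonneg hf] at h
  linarith

theorem norm_map_le_one (hf : ∀ a : A, 0 ≤ f (star a * a)) (h1 : f 1 = 1)
    {U : A} (hU : star U * U = 1) : ‖f U‖ ≤ 1 := by
  by_cases h0 : f U = 0
  · simp [h0]
  have hne : (‖f U‖ : ℂ) ≠ 0 := by simpa using h0
  -- The rotation by `c` moves `f U` to the negative real axis, where `neg_one_le_re_map` bounds its
  -- modulus.
  set c : ℂ := -(star (f U) / ‖f U‖)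
  have hc : star c * c = 1 := by
    have h := Complex.mul_conj (f U)
    rw [Complex.normSq_eq_norm_sq] at h
    simp only [c, star_neg, star_div₀, neg_mul_neg, Complex.star_def,
      Complex.conj_ofReal]
    field_simp
    simpa using h
  have hcU : star (c • U) * (c • U) = 1 := by
    rw [star_smul, smul_mul_smul_comm, hc, hU, one_smul]
  have h := neg_one_le_re_map hf h1 hcU
  have h2 : f (c • U) = ((-‖f U‖ : ℝ) : ℂ) := by
    have h := Complex.conj_mul' (f U)
    simp only [map_smul, smul_eq_mul, c, Complex.star_def]
    push_cast
    field_simp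
    simpa using h
  rw [h2, Complex.ofReal_re] at h
  linarith

end PositiveFunctional

/-! ### Pure states invariant under conjugation by a unitary. -/

section PureStates

open scoped ComplexOrder

variable {d : ℕ}

namespace WeylCStar

theorem stateSpace_nonneg {ω : WeakDual ℂ (WeylCStar d)} (hω : ω ∈ stateSpace d) (a : WeylCStar d) :
    0 ≤ (WeakDual.toStrongDual ω).toLinearMap (star a * a) := hω.1 a

theorem stateSpace_one {ω : WeakDual ℂ (WeylCStar d)} (hω : ω ∈ stateSpace d) :
    (WeakDual.toStrongDual ω).toLinearMap 1 = 1 := hω.2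

/-- The functional `a ↦ ω (b a b^*)`. -/
noncomputable def sandwich (ω : WeakDual ℂ (WeylCStar d)) (b : WeylCStar d) :
    WeakDual ℂ (WeylCStar d) :=
  StrongDual.toWeakDual ((WeakDual.toStrongDual ω).comp
    (ContinuousLinearMap.mulLeftRight ℂ (WeylCStar d) b (star b)))

theorem sandwich_apply (ω : WeakDual ℂ (WeylCStar d)) (b a : WeylCStar d) :
    sandwich ω b a = ω (b * a * star b) := rfl

theorem sandwich_nonneg {ω : WeakDual ℂ (WeylCStar d)} (hω : ω ∈ stateSpace d)
    (b a : WeylCStar d) : 0 ≤ sandwich ω b (star a * a) := by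
  have h := hω.1 (a * star b)
  rwa [star_mul, star_star, mul_assoc, ← mul_assoc (star a), ← mul_assoc b] at h

/-- Invariance collapses the quadratic term to a multiple of `ω`; the cross terms are odd in `z` and
cancel between `z` and `-z`. -/
theorem sandwich_one_add_smul {ω : WeakDual ℂ (WeylCStar d)} {U : WeylCStar d}
    (hinv : ∀ a, ω (U * a * star U) = ω a) (z : ℂ) (a : WeylCStar d) :
    sandwich ω (1 + z • U) a =
      (1 + z * star z) * ω a + (z * ω (U * a) + star z * ω (a * star U)) := by
  rw [sandwich_apply]
  simp only [star_add, star_one, star_smul, add_mul, mul_add, one_mul, mul_one, smul_mul_assoc,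
    mul_smul_comm, map_add, map_smul, smul_eq_mul, hinv]
  ring

/-- If a pure state is invariant under conjugation by a unitary `U`, then it is multiplicative
on `U`. -/
theorem map_unitary_mul_of_pure {ω : WeakDual ℂ (WeylCStar d)} (hω : ω ∈ pureStates d)
    {U : WeylCStar d} (hU : star U * U = 1)
    (hinv : ∀ a, ω (U * a * star U) = ω a) (a : WeylCStar d) :
    ω (U * a) = ω U * ω a := by
  have hs : ω ∈ stateSpace d := extremePoints_subset hω
  have hstar : ω (star U) = star (ω U) := map_star_of_nonneg (stateSpace_nonneg hs) U
  have hn : ‖ω U‖ ≤ 1 := norm_map_le_one (stateSpace_nonneg hs) (stateSpace_one hs) hU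
  -- The mass of the sandwiched functional when `|z| = 1/2`: `1 + |z|² + 2 Re (z ω U)`. It is
  -- positive because the last term is at least `-1`.
  let r : ℂ → ℝ := fun z => 5 / 4 + 2 * (z * ω U).re
  have hone (z : ℂ) (hz : ‖z‖ = 1 / 2) : sandwich ω (1 + z • U) 1 = r z := by
    rw [sandwich_one_add_smul hinv, one_mul, mul_one, hstar, hs.2, ← star_mul' z,
      Complex.star_def, Complex.mul_conj, Complex.add_conj,
      Complex.normSq_eq_norm_sq, hz]
    simp only [r]
    push_cast
    ring
  have hr (z : ℂ) (hz : ‖z‖ = 1 / 2) : 0 < r z := by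
    have h := Complex.abs_re_le_norm (z * ω U)
    rw [norm_mul, hz] at h
    have := neg_abs_le (z * ω U).re
    simp only [r]
    linarith
  let s : ℂ → WeakDual ℂ (WeylCStar d) := fun z => (r z)⁻¹ • sandwich ω (1 + z • U)
  have hsapp (z : ℂ) (b : WeylCStar d) : s z b = ((r z)⁻¹ : ℝ) • sandwich ω (1 + z • U) b := rfl
  have hstate (z : ℂ) (hz : ‖z‖ = 1 / 2) : s z ∈ stateSpace d := by
    refine ⟨fun b => ?_, ?_⟩
    · rw [hsapp]
      exact smul_nonneg (inv_nonneg.2 (hr z hz).le) (sandwich_nonneg hs _ b)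
    · rw [hsapp, hone z hz, Complex.real_smul, ← Complex.ofReal_mul, inv_mul_cancel₀ (hr z hz).ne',
        Complex.ofReal_one]
  have hzz (z : ℂ) (hz : ‖z‖ = 1 / 2) : z * star z = 1 / 4 := by
    rw [Complex.star_def, Complex.mul_conj, Complex.normSq_eq_norm_sq, hz]; norm_num
  have key (z : ℂ) (hz : ‖z‖ = 1 / 2) : z * ω (U * a) + star z * ω (a * star U) =
      (z * ω U + star z * star (ω U)) * ω a := by
    have hz' : ‖-z‖ = 1 / 2 := by rw [norm_neg, hz]
    have hsum : r z + r (-z) = 5 / 2 := by simp only [r, neg_mul, Complex.neg_re]; ring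
    -- With weights proportional to the masses the normalizations drop out, and the sum is `2 (1 +
    -- |z|²) ω = (5/2) ω`.
    have hseg : ω ∈ openSegment ℝ (s z) (s (-z)) := by
      refine ⟨r z / (5 / 2), r (-z) / (5 / 2), div_pos (hr z hz) (by norm_num),
        div_pos (hr _ hz') (by norm_num), by rw [← add_div, hsum]; norm_num, ?_⟩
      refine DFunLike.ext _ _ fun b => ?_
      change (r z / (5 / 2) : ℝ) • s z b + (r (-z) / (5 / 2) : ℝ) • s (-z) b = ω b
      rw [hsapp, hsapp, smul_smul, smul_smul, div_mul_eq_mul_div, div_mul_eq_mul_div,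
        mul_inv_cancel₀ (hr z hz).ne', mul_inv_cancel₀ (hr _ hz').ne', sandwich_one_add_smul hinv,
        sandwich_one_add_smul hinv, star_neg, neg_mul_neg, hzz z hz, Complex.real_smul,
        Complex.real_smul]
      push_cast
      ring
    have heq : s z = ω :=
      ((mem_extremePoints.1 hω).2 _ (hstate z hz) _ (hstate _ hz') hseg).1
    have h1 : sandwich ω (1 + z • U) a = r z * ω a := by
      have h := hsapp z a
      rw [heq, Complex.real_smul] at h
      rw [h, ← mul_assoc, ← Complex.ofReal_mul, mul_inv_cancel₀ (hr z hz).ne', Complex.ofReal_one,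
        one_mul]
    rw [← hone z hz, sandwich_one_add_smul hinv, sandwich_one_add_smul hinv, mul_one, one_mul,
      hstar, hs.2] at h1
    linear_combination h1
  -- A real and an imaginary `z` separate the linear part of `key` from the conjugate-linear one.
  have k1 := key (1 / 2) (by norm_num)
  have k2 := key (Complex.I / 2) (by norm_num)
  simp only [Complex.star_def, map_div₀, map_one, map_ofNat, Complex.conj_I] at k1 k2
  linear_combination k1 - Complex.I * k2 + (ω (U * a) / 2 - ω (a * star U) / 2 -
    ω a * (ω U / 2 - (starRingEnd ℂ) (ω U) / 2)) * Complex.I_mul_I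

/-- A pure state invariant under conjugation by a unitary `U` has modulus one on `U`. -/
theorem norm_map_eq_one_of_pure {ω : WeakDual ℂ (WeylCStar d)} (hω : ω ∈ pureStates d)
    {U : WeylCStar d} (hU : star U * U = 1) (hU' : U * star U = 1)
    (hinv : ∀ a, ω (U * a * star U) = ω a) : ‖ω U‖ = 1 := by
  have hs : ω ∈ stateSpace d := extremePoints_subset hω
  -- Multiplicativity at `star U` reads `1 = ω U * star (ω U)`.
  have h := map_unitary_mul_of_pure hω hU hinv (star U)
  have hstar : ω (star U) = star (ω U) := map_star_of_nonneg (stateSpace_nonneg hs) U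
  rw [hU', hs.2, hstar] at h
  have h2 := congrArg norm h
  rw [norm_one, norm_mul, norm_star] at h2
  nlinarith [norm_nonneg (ω U)]

/-! ### Monomials -/

theorem u_mul_v (α β : RSpace d) :
    u α * v β = ((WeylAlg.mono (α, β) 1 : WeylAlg d) : WeylCStar d) := by
  rw [u, v, ← UniformSpace.Completion.coe_mul, WeylAlg.mono_mul_mono]
  simp [phase_zero]

theorem u_add (α α' : RSpace d) : u (α + α') = u α * u α' := by
  rw [u, u, u, ← UniformSpace.Completion.coe_mul, WeylAlg.mono_mul_mono]
  simp [phase_zero]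

theorem v_add (β β' : RSpace d) : v (β + β') = v β * v β' := by
  rw [v, v, v, ← UniformSpace.Completion.coe_mul, WeylAlg.mono_mul_mono]
  simp [phase_zero]

theorem u_zero : (u 0 : WeylCStar d) = 1 := rfl

theorem v_zero : (v 0 : WeylCStar d) = 1 := rfl

theorem star_u (α : RSpace d) : star (u α) = u (-α) := by
  rw [u, u, ← coe_star, WeylAlg.star_mono]
  simp [phase_zero]

theorem star_v (β : RSpace d) : star (v β) = v (-β) := by
  rw [v, v, ← coe_star, WeylAlg.star_mono]
  simp [phase_zero]

theorem v_mul_u (α β : RSpace d) : v β * u α = phase (-(inner ℝ α β)) • (u α * v β) := by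
  rw [u_mul_v, u, v, ← UniformSpace.Completion.coe_mul, WeylAlg.mono_mul_mono,
    ← UniformSpace.Completion.coe_smul, WeylAlg.smul_mono]
  simp

theorem star_u_mul_u (α : RSpace d) : star (u α) * u α = 1 := by
  rw [star_u, ← u_add, neg_add_cancel, u_zero]

theorem u_mul_star_u (α : RSpace d) : u α * star (u α) = 1 := by
  rw [star_u, ← u_add, add_neg_cancel, u_zero]

theorem star_v_mul_v (β : RSpace d) : star (v β) * v β = 1 := by
  rw [star_v, ← v_add, neg_add_cancel, v_zero]

theorem v_mul_star_v (β : RSpace d) : v β * star (v β) = 1 := by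
  rw [star_v, ← v_add, add_neg_cancel, v_zero]

/-- Monomials are eigenvectors of conjugation by each `u γ'`, and by each `v γ` in `v_mul_monomial`;
an eigenvalue other than 1 is what forces a state to vanish there. -/
theorem u_mul_monomial (γ' α β : RSpace d) :
    u γ' * (u α * v β) = phase (inner ℝ γ' β) • ((u α * v β) * u γ') := by
  rw [mul_assoc (u α), v_mul_u, mul_smul_comm, smul_smul, phase_mul_phase_neg, one_smul,
    ← mul_assoc, ← mul_assoc, ← u_add, ← u_add, add_comm]

theorem v_mul_monomial (γ α β : RSpace d) :
    v γ * (u α * v β) = phase (-(inner ℝ α γ)) • ((u α * v β) * v γ) := by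
  rw [← mul_assoc, v_mul_u, smul_mul_assoc, mul_assoc, mul_assoc, ← v_add, ← v_add, add_comm]

theorem ext_of_monomials {ω ω' : WeakDual ℂ (WeylCStar d)}
    (h : ∀ α β, ω (u α * v β) = ω' (u α * v β)) : ω = ω' := by
  refine DFunLike.ext _ _ fun a => ?_
  induction a using UniformSpace.Completion.induction_on with
  | hp => exact isClosed_eq (map_continuous ω) (map_continuous ω')
  | ih a =>
    induction a using WeylAlg.induction_mono with
    | h0 => rw [UniformSpace.Completion.coe_zero, map_zero, map_zero]
    | hadd f g hf hg => rw [UniformSpace.Completion.coe_add, map_add, map_add, hf, hg]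
    | hmono p c =>
      have h1 : WeylAlg.mono p c = c • WeylAlg.mono (p.1, p.2) 1 := by
        rw [WeylAlg.smul_mono, mul_one]
      rw [h1, UniformSpace.Completion.coe_smul, map_smul, map_smul, ← u_mul_v, h]

end WeylCStar

end PureStates

/-! ### The representation induced from a character of `Γ' × Γ`. -/

section TwistedRepresentation

open scoped ENNReal

/-- Composition with a permutation of the index set and multiplication by phases, as an isometry
of `ℓ²`. -/
noncomputable def phasedPerm {Q : Type} (w : Q → ℂ) (hw : ∀ x, ‖w x‖ = 1) (σ : Q ≃ Q) :
    lp (fun _ : Q => ℂ) 2 →ₗᵢ[ℂ] lp (fun _ : Q => ℂ) 2 where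
  toFun f := ⟨fun x => w x * f (σ x), by
    refine memℓp_gen ?_
    have h := (lp.memℓp f).summable (by norm_num)
    simpa [hw, Function.comp_def] using (σ.summable_iff.2 h)⟩
  map_add' f g := by ext x; exact mul_add _ _ _
  map_smul' c f := by ext x; exact mul_left_comm _ _ _
  norm_map' f := by
    have h2 : 0 < (2 : ℝ≥0∞).toReal := by norm_num
    change ‖(⟨fun x => w x * f (σ x), _⟩ : lp (fun _ : Q => ℂ) 2)‖ = _
    rw [lp.norm_eq_tsum_rpow h2, lp.norm_eq_tsum_rpow h2 f]
    congr 1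
    simp only [norm_mul, hw, one_mul]
    exact σ.tsum_eq (fun x => ‖f x‖ ^ (2 : ℝ≥0∞).toReal)

variable {d : ℕ} (Γ : AddSubgroup (RSpace d)) (κ ν : RSpace d)

/-- The phase space lattice `Γ' × Γ`. -/
abbrev phaseLattice : AddSubgroup (RSpace d × RSpace d) := (dualLattice Γ).prod Γ

/-- Phase space modulo `Γ' × Γ`. -/
abbrev PhaseCell : Type := (RSpace d × RSpace d) ⧸ phaseLattice Γ

variable {Γ}

/-- A set-theoretic section of the quotient map to the phase cell. -/
noncomputable def cellSection (x : PhaseCell Γ) : RSpace d × RSpace d := Quotient.out x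

theorem mk_cellSection (x : PhaseCell Γ) : (cellSection x : PhaseCell Γ) = x := Quotient.out_eq x

/-- The lattice part of the translate by `p` of the representative of `x`. -/
noncomputable def cellShift (p : RSpace d × RSpace d) (x : PhaseCell Γ) : RSpace d × RSpace d :=
  p + cellSection x - cellSection ((p : PhaseCell Γ) + x)

theorem cellShift_mem (p : RSpace d × RSpace d) (x : PhaseCell Γ) :
    cellShift p x ∈ phaseLattice Γ := by
  rw [← QuotientAddGroup.eq_zero_iff, cellShift, QuotientAddGroup.mk_sub, QuotientAddGroup.mk_add,
    mk_cellSection, mk_cellSection, sub_self]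

theorem cellShift_add (p q : RSpace d × RSpace d) (x : PhaseCell Γ) :
    cellShift (p + q) x = cellShift p ((q : PhaseCell Γ) + x) + cellShift q x := by
  simp only [cellShift, QuotientAddGroup.mk_add, add_assoc]
  abel

/-- The exponent of the matrix element of `u_p.1 v_p.2` at `x`. -/
noncomputable def cellExponent (p : RSpace d × RSpace d) (x : PhaseCell Γ) : ℝ :=
  -(inner ℝ (cellSection x).1 p.2)
    + inner ℝ (cellShift p x).1 (cellSection ((p : PhaseCell Γ) + x)).2
    - inner ℝ κ (cellShift p x).2 - inner ℝ (cellShift p x).1 ν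

/-- Let `Ω` be a formal joint eigenvector of the lattice unitaries, and let the basis vector at `x`
stand for `u r.1 * v r.2` applied to `Ω`, with `r = cellSection x`. Reordering `u p.1 * v p.2 * u
r.1 * v r.2` gives `cellExponent`. The exponents compose correctly up to an inner product of `Γ'`
with `Γ`, which has phase 1. -/
theorem cellExponent_add (p q : RSpace d × RSpace d) (x : PhaseCell Γ) :
    cellExponent κ ν p ((q : PhaseCell Γ) + x) + cellExponent κ ν q x =
      -(inner ℝ q.1 p.2) + cellExponent κ ν (p + q) x
        + inner ℝ (cellShift q x).1 (cellShift p ((q : PhaseCell Γ) + x)).2 := by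
  have hr : (cellSection ((q : PhaseCell Γ) + x)) = q + cellSection x - cellShift q x := by
    rw [cellShift]; abel
  have hr' : (cellSection ((p : PhaseCell Γ) + ((q : PhaseCell Γ) + x))) =
      p + (q + cellSection x - cellShift q x) - cellShift p ((q : PhaseCell Γ) + x) := by
    rw [← hr, cellShift]; abel
  simp only [cellExponent, cellShift_add, QuotientAddGroup.mk_add, add_assoc, hr', hr, Prod.fst_add,
    Prod.snd_add, Prod.fst_sub, Prod.snd_sub, inner_add_left, inner_add_right, inner_sub_left,
    inner_sub_right]
  ring

theorem phase_cellExponent_mul (p q : RSpace d × RSpace d) (x : PhaseCell Γ) :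
    phase (cellExponent κ ν p ((q : PhaseCell Γ) + x)) * phase (cellExponent κ ν q x) =
      phase (-(inner ℝ q.1 p.2)) * phase (cellExponent κ ν (p + q) x) := by
  rw [← phase_add, cellExponent_add, phase_add, phase_add,
    phase_inner_eq_one (cellShift_mem q x).1 (cellShift_mem p _).2, mul_one]

theorem cellExponent_zero (x : PhaseCell Γ) : cellExponent κ ν 0 x = 0 := by
  have h : cellShift 0 x = 0 := by simp [cellShift]
  simp [cellExponent, h]

/-- The unitary operator representing the monomial `u_p.1 v_p.2`. -/
noncomputable def cellOp (p : RSpace d × RSpace d) :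
    lp (fun _ : PhaseCell Γ => ℂ) 2 →ₗᵢ[ℂ] lp (fun _ : PhaseCell Γ => ℂ) 2 :=
  phasedPerm (fun x => phase (cellExponent κ ν p (-(p : PhaseCell Γ) + x)))
    (fun _ => norm_phase _) (Equiv.addLeft (-(p : PhaseCell Γ)))

theorem cellOp_apply (p : RSpace d × RSpace d) (f : lp (fun _ : PhaseCell Γ => ℂ) 2)
    (x : PhaseCell Γ) : cellOp κ ν p f x =
      phase (cellExponent κ ν p (-(p : PhaseCell Γ) + x)) * f (-(p : PhaseCell Γ) + x) := rfl

/-- `cellOp` as a bounded operator. -/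
noncomputable def cellCLM (p : RSpace d × RSpace d) :
    lp (fun _ : PhaseCell Γ => ℂ) 2 →L[ℂ] lp (fun _ : PhaseCell Γ => ℂ) 2 :=
  (cellOp κ ν p).toContinuousLinearMap

theorem cellCLM_mul (p q : RSpace d × RSpace d) :
    (cellCLM κ ν p * cellCLM κ ν q : lp (fun _ : PhaseCell Γ => ℂ) 2 →L[ℂ] _) =
      phase (-(inner ℝ q.1 p.2)) • cellCLM κ ν (p + q) := by
  ext f x
  change cellOp κ ν p (cellOp κ ν q f) x = phase _ * cellOp κ ν (p + q) f x
  have h : -((p + q : RSpace d × RSpace d) : PhaseCell Γ) + x =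
      -(q : PhaseCell Γ) + (-(p : PhaseCell Γ) + x) := by
    rw [QuotientAddGroup.mk_add]; abel
  have h2 := phase_cellExponent_mul κ ν p q (-(q : PhaseCell Γ) + (-(p : PhaseCell Γ) + x))
  rw [add_neg_cancel_left] at h2
  rw [cellOp_apply, cellOp_apply, cellOp_apply, h, ← mul_assoc, ← mul_assoc, h2]

theorem cellCLM_zero : (cellCLM κ ν 0 : lp (fun _ : PhaseCell Γ => ℂ) 2 →L[ℂ] _) = 1 := by
  ext f x
  change cellOp κ ν 0 f x = f x
  rw [cellOp_apply, cellExponent_zero, phase_zero, QuotientAddGroup.mk_zero, neg_zero, zero_add,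
    one_mul]

/-- The adjoint is a left inverse because the operator is isometric, the right side is a right
inverse by the product formula, and the two must coincide. -/
theorem star_cellCLM (p : RSpace d × RSpace d) :
    star (cellCLM κ ν p : lp (fun _ : PhaseCell Γ => ℂ) 2 →L[ℂ] _) =
      phase (-(inner ℝ p.1 p.2)) • cellCLM κ ν (-p) := by
  have h1 : star (cellCLM κ ν p : lp (fun _ : PhaseCell Γ => ℂ) 2 →L[ℂ] _) * cellCLM κ ν p = 1 := by
    refine ContinuousLinearMap.ext fun f => ext_inner_left ℂ fun g => ?_
    change inner ℂ g (ContinuousLinearMap.adjoint (cellCLM κ ν p) (cellCLM κ ν p f)) = inner ℂ g f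
    rw [ContinuousLinearMap.adjoint_inner_right]
    exact (cellOp κ ν p).inner_map_map g f
  have h2 : (cellCLM κ ν p : lp (fun _ : PhaseCell Γ => ℂ) 2 →L[ℂ] _) *
      (phase (-(inner ℝ p.1 p.2)) • cellCLM κ ν (-p)) = 1 := by
    rw [mul_smul_comm, cellCLM_mul, smul_smul, add_neg_cancel, cellCLM_zero, Prod.fst_neg,
      inner_neg_left, neg_neg, phase_neg_mul_phase, one_smul]
  exact left_inv_eq_right_inv h1 h2

/-- The twisted representation of the Weyl algebra on `ℓ²` of the phase cell. -/
noncomputable def cellHom (Γ : AddSubgroup (RSpace d)) (κ ν : RSpace d) :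
    WeylAlg d →⋆ₐ[ℂ] (lp (fun _ : PhaseCell Γ => ℂ) 2 →L[ℂ] lp (fun _ : PhaseCell Γ => ℂ) 2) :=
    { (WeylAlg.lift (cellCLM κ ν) :
        WeylAlg d →ₗ[ℂ] (lp (fun _ : PhaseCell Γ => ℂ) 2 →L[ℂ] lp (fun _ : PhaseCell Γ => ℂ) 2)) with
      map_one' := by
        change WeylAlg.lift (cellCLM κ ν) (1 : WeylAlg d) = 1
        rw [WeylAlg.one_def, WeylAlg.lift_mono, cellCLM_zero, one_smul]
      map_zero' := map_zero _
      map_mul' := fun a b => by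
        change WeylAlg.lift (cellCLM κ ν) (a * b) =
          WeylAlg.lift (cellCLM κ ν) a * WeylAlg.lift (cellCLM κ ν) b
        induction a using WeylAlg.induction_mono with
        | h0 => rw [zero_mul, map_zero, zero_mul]
        | hadd f g hf hg => rw [add_mul, map_add, map_add, add_mul, hf, hg]
        | hmono p a =>
          induction b using WeylAlg.induction_mono with
          | h0 => rw [mul_zero, map_zero, mul_zero]
          | hadd f g hf hg => rw [mul_add, map_add, map_add, mul_add, hf, hg]
          | hmono q b =>
            rw [WeylAlg.mono_mul_mono, WeylAlg.lift_mono, WeylAlg.lift_mono, WeylAlg.lift_mono,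
              smul_mul_smul_comm, cellCLM_mul, smul_smul]
      commutes' := fun c => by
        change WeylAlg.lift (cellCLM κ ν) (algebraMap ℂ (WeylAlg d) c) = _
        rw [Algebra.algebraMap_eq_smul_one, map_smul, WeylAlg.one_def, WeylAlg.lift_mono,
          cellCLM_zero, one_smul, Algebra.algebraMap_eq_smul_one]
      map_star' := fun a => by
        change WeylAlg.lift (cellCLM κ ν) (star a) = star (WeylAlg.lift (cellCLM κ ν) a)
        induction a using WeylAlg.induction_mono with
        | h0 => rw [star_zero, map_zero, star_zero]
        | hadd f g hf hg => rw [star_add, map_add, map_add, star_add, hf, hg]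
        | hmono p a =>
          rw [WeylAlg.star_mono, WeylAlg.lift_mono, WeylAlg.lift_mono, star_smul, star_cellCLM,
            smul_smul] }

theorem cellHom_mono (p : RSpace d × RSpace d) :
    cellHom Γ κ ν (WeylAlg.mono p 1) = cellCLM κ ν p :=
  (WeylAlg.lift_mono (cellCLM κ ν) p 1).trans (one_smul _ _)

open scoped Classical in
/-- The basis vector of `ℓ²` at the class of the origin. -/
noncomputable def originVector (Γ : AddSubgroup (RSpace d)) : lp (fun _ : PhaseCell Γ => ℂ) 2 :=
  lp.single 2 0 1

theorem norm_originVector (Γ : AddSubgroup (RSpace d)) : ‖originVector Γ‖ = 1 := by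
  classical
  rw [originVector, lp.norm_single (by norm_num), norm_one]

theorem inner_originVector_cellCLM (α β : RSpace d) :
    inner ℂ (originVector Γ) (cellCLM κ ν (α, β) (originVector Γ)) = zakValue Γ κ ν α β := by
  classical
  have h1 : inner ℂ (originVector Γ) (cellCLM κ ν (α, β) (originVector Γ)) =
      cellOp κ ν (α, β) (originVector Γ) 0 := by
    have h := lp.inner_single_left (𝕜 := ℂ) (G := fun _ : PhaseCell Γ => ℂ) 0 (1 : ℂ)
      (cellOp κ ν (α, β) (originVector Γ))
    refine h.trans ?_
    simp
  rw [h1, cellOp_apply, add_zero, zakValue]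
  by_cases hp : (α, β) ∈ phaseLattice Γ
  · have h0 : ((α, β) : PhaseCell Γ) = 0 := (QuotientAddGroup.eq_zero_iff _).2 hp
    -- The chosen representative of the zero class need not be 0; being in the lattice, it
    -- contributes only the trivial phases `e1` and `e2`.
    have hs : cellSection (0 : PhaseCell Γ) ∈ phaseLattice Γ := by
      rw [← QuotientAddGroup.eq_zero_iff, mk_cellSection]
    have hshift : cellShift (α, β) (0 : PhaseCell Γ) = (α, β) := by
      rw [cellShift, h0, zero_add, add_sub_cancel_right]
    have hv : (originVector Γ) (0 : PhaseCell Γ) = 1 := by simp [originVector]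
    have e1 : phase (-(inner ℝ (cellSection (0 : PhaseCell Γ)).1 β)) = 1 := by
      rw [← inner_neg_right]; exact phase_inner_eq_one hs.1 (neg_mem hp.2)
    have e2 : phase (inner ℝ α (cellSection (0 : PhaseCell Γ)).2) = 1 :=
      phase_inner_eq_one hp.1 hs.2
    rw [h0, neg_zero, hv, cellExponent, hshift, h0, add_zero, sub_eq_add_neg, sub_eq_add_neg,
      phase_add, phase_add, phase_add, e1, e2, if_pos (show α ∈ dualLattice Γ from hp.1),
      if_pos (show β ∈ Γ from hp.2)]
    ring
  · have h0 : -((α, β) : PhaseCell Γ) ≠ 0 := by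
      rw [neg_ne_zero, Ne, QuotientAddGroup.eq_zero_iff]; exact hp
    have hv : (originVector Γ) (-((α, β) : PhaseCell Γ)) = 0 := by
      simp [originVector, h0]
    rw [hv, mul_zero]
    by_cases hα : α ∈ dualLattice Γ
    · rw [if_neg (fun hβ : β ∈ Γ => hp ⟨hα, hβ⟩)]; ring
    · rw [if_neg hα]; ring

end TwistedRepresentation

/-! ### Vector states of the completed algebra. -/

section VectorState

open scoped ComplexOrder
open UniformSpace

variable {d : ℕ}

/-- The bound `‖ω a‖ ≤ ‖a‖` is kept because it is uniform over all representations, which the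
continuity in `(κ, ν)` relies on. -/
theorem exists_vectorState (π : WeylRep d) (ξ : π.H) (hξ : ‖ξ‖ = 1) :
    ∃ ω ∈ WeylCStar.stateSpace d, (∀ a : WeylAlg d, ω (a : WeylCStar d) = inner ℂ ξ (π.rho a ξ)) ∧
      ∀ a, ‖ω a‖ ≤ ‖a‖ := by
  have hbound (a : WeylAlg d) : ‖inner ℂ ξ (π.rho a ξ)‖ ≤ 1 * ‖a‖ := by
    refine (norm_inner_le_norm _ _).trans ?_
    have h := (π.rho a).le_opNorm ξ
    rw [hξ, mul_one] at h
    rw [hξ, one_mul, one_mul]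
    exact h.trans (WeylAlg.le_norm π a)
  let φ : WeylAlg d →L[ℂ] ℂ := LinearMap.mkContinuous
    { toFun := fun a => inner ℂ ξ (π.rho a ξ)
      map_add' := fun a b => by simp
      map_smul' := fun c a => by simp } 1 hbound
  let ω : WeakDual ℂ (WeylCStar d) := StrongDual.toWeakDual
    (φ.extend (Completion.toComplL : WeylAlg d →L[ℂ] WeylCStar d))
  have hω (a : WeylAlg d) : ω (a : WeylCStar d) = inner ℂ ξ (π.rho a ξ) :=
    ContinuousLinearMap.extend_eq _ Completion.denseRange_coe
      (Completion.isUniformInducing_coe _) a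
  refine ⟨ω, ⟨fun a => ?_, ?_⟩, hω, fun a => ?_⟩
  · induction a using Completion.induction_on with
    | hp =>
      exact isClosed_le continuous_const ((map_continuous ω).comp
        (WeylCStar.continuous_star'.mul continuous_id))
    | ih a =>
      rw [← WeylCStar.coe_star, ← Completion.coe_mul, hω, map_mul, map_star]
      change 0 ≤ inner ℂ ξ (ContinuousLinearMap.adjoint (π.rho a) (π.rho a ξ))
      rw [ContinuousLinearMap.adjoint_inner_right, inner_self_eq_norm_sq_to_K]
      norm_cast
      positivity
  · rw [← Completion.coe_one, hω, map_one]
    change inner ℂ ξ ξ = 1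
    rw [inner_self_eq_norm_sq_to_K, hξ]
    simp
  · induction a using Completion.induction_on with
    | hp => exact isClosed_le (map_continuous ω).norm continuous_norm
    | ih a =>
      rw [hω, Completion.norm_coe, ← one_mul ‖a‖]
      exact hbound a

/-- Existence of the Zak states. -/
theorem exists_zakState (Γ : AddSubgroup (RSpace d)) (κ ν : RSpace d) :
    ∃ ω ∈ WeylCStar.stateSpace d,
      (∀ α β, ω (WeylCStar.u α * WeylCStar.v β) = zakValue Γ κ ν α β) ∧ ∀ a, ‖ω a‖ ≤ ‖a‖ := by
  obtain ⟨ω, hω, hval, hle⟩ := exists_vectorState ⟨_, cellHom Γ κ ν⟩ (originVector Γ)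
    (norm_originVector Γ)
  refine ⟨ω, hω, fun α β => ?_, hle⟩
  rw [WeylCStar.u_mul_v, hval]
  change inner ℂ (originVector Γ) (cellHom Γ κ ν _ (originVector Γ)) = _
  rw [cellHom_mono]
  exact inner_originVector_cellCLM κ ν α β

end VectorState

/-! ### Classification of the pure Zak states and their topology. -/

section ZakStates

open scoped ComplexOrder
open UniformSpace WeylCStar

variable {d : ℕ}

theorem zakValue_of_not_mem_left {Γ : AddSubgroup (RSpace d)} {α : RSpace d}
    (h : α ∉ dualLattice Γ) (κ ν β : RSpace d) : zakValue Γ κ ν α β = 0 := by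
  rw [zakValue, if_neg h]; ring

theorem zakValue_of_not_mem_right {Γ : AddSubgroup (RSpace d)} {β : RSpace d}
    (h : β ∉ Γ) (κ ν α : RSpace d) : zakValue Γ κ ν α β = 0 := by
  rw [zakValue, if_neg h]; ring

theorem zakValue_of_mem {Γ : AddSubgroup (RSpace d)} {α β : RSpace d}
    (hα : α ∈ dualLattice Γ) (hβ : β ∈ Γ) (κ ν : RSpace d) :
    zakValue Γ κ ν α β = phase (-(inner ℝ κ β)) * phase (-(inner ℝ α ν)) := by
  rw [zakValue, if_pos hα, if_pos hβ]; ring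

theorem continuous_zakValue (Γ : AddSubgroup (RSpace d)) (α β : RSpace d) :
    Continuous fun q : RSpace d × RSpace d => zakValue Γ q.1 q.2 α β := by
  unfold zakValue
  fun_prop

variable (e : Module.Basis (Fin d) ℝ (RSpace d))

theorem exists_phase_ne_one_of_not_mem_dualLattice {Γ : AddSubgroup (RSpace d)} {α : RSpace d}
    (h : α ∉ dualLattice Γ) : ∃ γ ∈ Γ, phase (-(inner ℝ α γ)) ≠ 1 := by
  by_contra! hc
  refine h fun γ hγ => (phase_eq_one_iff _).1 ?_
  have h1 := phase_neg_mul_phase (inner ℝ α γ)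
  rwa [hc γ hγ, one_mul] at h1

variable {e} in
theorem exists_phase_ne_one_of_not_mem_lattice {β : RSpace d}
    (h : β ∉ latticeOf e) : ∃ γ' ∈ dualLattice (latticeOf e), phase (inner ℝ γ' β) ≠ 1 := by
  by_contra! hc
  exact h (mem_latticeOf_of_inner e fun γ' hγ' => (phase_eq_one_iff _).1 (hc γ' hγ'))

/-- A state is determined by its values on the lattice unitaries when these have modulus one. -/
theorem eq_zakValue_of_lattice_values {κ ν : RSpace d} {ω : WeakDual ℂ (WeylCStar d)}
    (hω : ω ∈ stateSpace d)
    (hu : ∀ γ' ∈ dualLattice (latticeOf e), ω (u γ') = phase (-(inner ℝ γ' ν)))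
    (hv : ∀ γ ∈ latticeOf e, ω (v γ) = phase (-(inner ℝ κ γ))) (α β : RSpace d) :
    ω (u α * v β) = zakValue (latticeOf e) κ ν α β := by
  have hul (γ' : RSpace d) (hγ' : γ' ∈ dualLattice (latticeOf e)) (a : WeylCStar d) :
      ω (u γ' * a) = ω (u γ') * ω a :=
    map_mul_of_norm_eq_one_left (stateSpace_nonneg hω) (stateSpace_one hω) (u_mul_star_u γ')
      ((congrArg norm (hu γ' hγ')).trans (norm_phase _)) a
  have hur (γ' : RSpace d) (hγ' : γ' ∈ dualLattice (latticeOf e)) (a : WeylCStar d) :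
      ω (a * u γ') = ω a * ω (u γ') :=
    map_mul_of_norm_eq_one_right (stateSpace_nonneg hω) (stateSpace_one hω) (star_u_mul_u γ')
      ((congrArg norm (hu γ' hγ')).trans (norm_phase _)) a
  have hvl (γ : RSpace d) (hγ : γ ∈ latticeOf e) (a : WeylCStar d) :
      ω (v γ * a) = ω (v γ) * ω a :=
    map_mul_of_norm_eq_one_left (stateSpace_nonneg hω) (stateSpace_one hω) (v_mul_star_v γ)
      ((congrArg norm (hv γ hγ)).trans (norm_phase _)) a
  have hvr (γ : RSpace d) (hγ : γ ∈ latticeOf e) (a : WeylCStar d) :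
      ω (a * v γ) = ω a * ω (v γ) :=
    map_mul_of_norm_eq_one_right (stateSpace_nonneg hω) (stateSpace_one hω) (star_v_mul_v γ)
      ((congrArg norm (hv γ hγ)).trans (norm_phase _)) a
  by_cases hα : α ∈ dualLattice (latticeOf e)
  · by_cases hβ : β ∈ latticeOf e
    · rw [hul α hα, hu α hα, hv β hβ, zakValue_of_mem hα hβ, mul_comm]
    · obtain ⟨γ', hγ', hne⟩ := exists_phase_ne_one_of_not_mem_lattice hβ
      -- Multiplicativity on both sides allows `ω (u γ')` to be cancelled, leaving `m = m * phase`
      -- for the value `m` at the monomial, with a phase other than 1.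
      have h := congrArg ω (u_mul_monomial γ' α β)
      rw [map_smul, hul γ' hγ', hur γ' hγ', smul_eq_mul, mul_comm (ω (u γ')), ← mul_assoc] at h
      have h0 : ω (u γ') ≠ 0 := by rw [hu γ' hγ']; exact phase_ne_zero _
      have h1 := mul_right_cancel₀ h0 h
      rw [zakValue_of_not_mem_right hβ]
      by_contra hm
      exact hne ((right_eq_mul₀ hm).1 h1)
  · obtain ⟨γ, hγ, hne⟩ := exists_phase_ne_one_of_not_mem_dualLattice hα
    have h := congrArg ω (v_mul_monomial γ α β)
    rw [map_smul, hvl γ hγ, hvr γ hγ, smul_eq_mul, mul_comm (ω (v γ)), ← mul_assoc] at h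
    have h0 : ω (v γ) ≠ 0 := by rw [hv γ hγ]; exact phase_ne_zero _
    have h1 := mul_right_cancel₀ h0 h
    rw [zakValue_of_not_mem_left hα]
    by_contra hm
    exact hne ((right_eq_mul₀ hm).1 h1)

/-- The Zak state with parameters `κ` and `ν`. -/
noncomputable def zakState (Γ : AddSubgroup (RSpace d)) (κ ν : RSpace d) :
    WeakDual ℂ (WeylCStar d) := (exists_zakState Γ κ ν).choose

theorem zakState_mem_stateSpace (Γ : AddSubgroup (RSpace d)) (κ ν : RSpace d) :
    zakState Γ κ ν ∈ stateSpace d := (exists_zakState Γ κ ν).choose_spec.1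

theorem zakState_apply (Γ : AddSubgroup (RSpace d)) (κ ν α β : RSpace d) :
    zakState Γ κ ν (u α * v β) = zakValue Γ κ ν α β := (exists_zakState Γ κ ν).choose_spec.2.1 α β

theorem norm_zakState_apply_le (Γ : AddSubgroup (RSpace d)) (κ ν : RSpace d) (a : WeylCStar d) :
    ‖zakState Γ κ ν a‖ ≤ ‖a‖ := (exists_zakState Γ κ ν).choose_spec.2.2 a

theorem zakState_u {Γ : AddSubgroup (RSpace d)} (κ ν : RSpace d) {γ' : RSpace d}
    (h : γ' ∈ dualLattice Γ) : zakState Γ κ ν (u γ') = phase (-(inner ℝ γ' ν)) := by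
  have h1 := zakState_apply Γ κ ν γ' 0
  rwa [v_zero, mul_one, zakValue_of_mem h (zero_mem _), inner_zero_right, neg_zero, phase_zero,
    one_mul] at h1

theorem zakState_v {Γ : AddSubgroup (RSpace d)} (κ ν : RSpace d) {γ : RSpace d}
    (h : γ ∈ Γ) : zakState Γ κ ν (v γ) = phase (-(inner ℝ κ γ)) := by
  have h1 := zakState_apply Γ κ ν 0 γ
  rwa [u_zero, one_mul, zakValue_of_mem (zero_mem _) h, inner_zero_left, neg_zero, phase_zero,
    mul_one] at h1

/-- Strict convexity of the disc: a nondegenerate open segment in it avoids the unit circle. -/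
theorem eq_of_mem_openSegment_of_norm_eq_one {z z₁ z₂ : ℂ} (hz : ‖z‖ = 1) (h₁ : ‖z₁‖ ≤ 1)
    (h₂ : ‖z₂‖ ≤ 1) (h : z ∈ openSegment ℝ z₁ z₂) : z₁ = z := by
  by_contra hne
  have hne' : z₁ ≠ z₂ := by
    rintro rfl
    rw [openSegment_same] at h
    exact hne h.symm
  have hlt := openSegment_subset_ball_of_ne (z := (0 : ℂ)) (r := 1)
    (mem_closedBall_zero_iff.2 h₁) (mem_closedBall_zero_iff.2 h₂) hne' h
  rw [mem_ball_zero_iff, hz] at hlt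
  exact lt_irrefl _ hlt

theorem zakState_mem_pureStates (κ ν : RSpace d) :
    zakState (latticeOf e) κ ν ∈ pureStates d := by
  refine mem_extremePoints_iff_left.2 ⟨zakState_mem_stateSpace _ κ ν, fun ω₁ h₁ ω₂ h₂ hseg => ?_⟩
  have key (U : WeylCStar d) (hU : star U * U = 1) (hn : ‖zakState (latticeOf e) κ ν U‖ = 1) :
      ω₁ U = zakState (latticeOf e) κ ν U := by
    refine eq_of_mem_openSegment_of_norm_eq_one hn
      (norm_map_le_one (stateSpace_nonneg h₁) (stateSpace_one h₁) hU)
      (norm_map_le_one (stateSpace_nonneg h₂) (stateSpace_one h₂) hU) ?_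
    obtain ⟨a, b, ha, hb, hab, h⟩ := hseg
    exact ⟨a, b, ha, hb, hab, congrArg (fun ω : WeakDual ℂ (WeylCStar d) => ω U) h⟩
  refine ext_of_monomials fun α β => ?_
  rw [zakState_apply]
  refine eq_zakValue_of_lattice_values e h₁ (fun γ' h => ?_) (fun γ h => ?_) α β
  · rw [← zakState_u κ ν h]
    exact key _ (star_u_mul_u γ') (by rw [zakState_u κ ν h, norm_phase])
  · rw [← zakState_v κ ν h]
    exact key _ (star_v_mul_v γ) (by rw [zakState_v κ ν h, norm_phase])

theorem tau_theta (γ γ' : RSpace d) (a : WeylCStar d) :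
    tau γ (theta γ' a) = (v γ * u γ') * a * star (v γ * u γ') := by
  simp only [tau, theta, star_mul, mul_assoc]

theorem tau_theta_monomial (γ γ' α β : RSpace d) :
    tau γ (theta γ' (u α * v β)) =
      (phase (inner ℝ γ' β) * phase (-(inner ℝ α γ))) • (u α * v β) := by
  rw [theta, u_mul_monomial, smul_mul_assoc, mul_assoc (u α * v β), u_mul_star_u, mul_one, tau,
    mul_smul_comm, v_mul_monomial, smul_smul, smul_mul_assoc, mul_assoc (u α * v β), v_mul_star_v,
    mul_one]

/-- On a monomial the action is a scalar: it is 1 for indices in `Γ' × Γ`, and for all other indices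
the state vanishes. -/
theorem zakState_mem_zakStates (Γ : AddSubgroup (RSpace d)) (κ ν : RSpace d) :
    zakState Γ κ ν ∈ zakStates Γ := by
  refine ⟨zakState_mem_stateSpace _ κ ν, fun γ hγ γ' hγ' a => ?_⟩
  have h : sandwich (zakState Γ κ ν) (v γ * u γ') = zakState Γ κ ν := by
    refine ext_of_monomials fun α β => ?_
    rw [sandwich_apply, ← tau_theta, tau_theta_monomial, map_smul, zakState_apply, smul_eq_mul]
    by_cases hα : α ∈ dualLattice Γ
    · by_cases hβ : β ∈ Γ
      · rw [phase_inner_eq_one hγ' hβ, ← inner_neg_right, phase_inner_eq_one hα (neg_mem hγ),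
          one_mul, one_mul]
      · rw [zakValue_of_not_mem_right hβ, mul_zero]
    · rw [zakValue_of_not_mem_left hα, mul_zero]
  rw [tau_theta, ← sandwich_apply, h]

/-- Every pure Zak state is one of the states `zakState`. -/
theorem exists_eq_zakState {ω : WeakDual ℂ (WeylCStar d)} (hω : ω ∈ pureZakStates (latticeOf e)) :
    ∃ κ ν, zakState (latticeOf e) κ ν = ω := by
  obtain ⟨⟨hs, hinv⟩, hp⟩ := hω
  have hu (γ' : RSpace d) (h : γ' ∈ dualLattice (latticeOf e)) (a : WeylCStar d) :
      ω (u γ' * a * star (u γ')) = ω a := by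
    -- Setting one lattice vector to 0 splits the joint invariance into invariance under each `u γ'`
    -- and each `v γ`.
    have h1 := hinv 0 (zero_mem _) γ' h a
    rwa [tau_theta, v_zero, one_mul] at h1
  have hv (γ : RSpace d) (h : γ ∈ latticeOf e) (a : WeylCStar d) :
      ω (v γ * a * star (v γ)) = ω a := by
    have h1 := hinv γ h 0 (zero_mem _) a
    rwa [tau_theta, u_zero, mul_one] at h1
  obtain ⟨κ, hκ⟩ := exists_phase_inner_eq e (fun x => ω (v x))
    (fun x hx => norm_map_eq_one_of_pure hp (star_v_mul_v x) (v_mul_star_v x) (hv x hx))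
    (fun x hx y _ => by
      rw [v_add]; exact map_unitary_mul_of_pure hp (star_v_mul_v x) (hv x hx) _)
  have hdual := dualLattice_latticeOf e
  obtain ⟨ν, hν⟩ := exists_phase_inner_eq (dualLatticeBasis e) (fun x => ω (u x))
    (fun x hx => norm_map_eq_one_of_pure hp (star_u_mul_u x) (u_mul_star_u x)
      (hu x (hdual ▸ hx)))
    (fun x hx y _ => by
      rw [u_add]; exact map_unitary_mul_of_pure hp (star_u_mul_u x) (hu x (hdual ▸ hx)) _)
  refine ⟨-κ, -ν, ext_of_monomials fun α β => ?_⟩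
  rw [zakState_apply]
  refine (eq_zakValue_of_lattice_values e hs (fun γ' h => ?_) (fun γ h => ?_) α β).symm
  · rw [inner_neg_right, neg_neg, real_inner_comm]
    exact hν γ' (hdual ▸ h)
  · rw [inner_neg_left, neg_neg]
    exact hκ γ h

/-- Comparing values at `v γ` and `u γ'` gives congruences modulo `2π`; those for `κ` define `Γ'`,
those for `ν` give `Γ` by double duality. -/
theorem zakState_eq_iff (κ ν κ' ν' : RSpace d) :
    zakState (latticeOf e) κ ν = zakState (latticeOf e) κ' ν' ↔
      (κ : BrillouinZone (latticeOf e)) = κ' ∧ (ν : LatticeTorus (latticeOf e)) = ν' := by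
  have hphase (s t : ℝ) : phase (-s) = phase (-t) ↔ ∃ n : ℤ, -s + t = 2 * Real.pi * n := by
    rw [← phase_eq_one_iff, phase_add]
    constructor
    · intro h; rw [h, phase_neg_mul_phase]
    · intro h
      refine mul_right_cancel₀ (phase_ne_zero t) ?_
      rw [h, phase_neg_mul_phase]
  rw [QuotientAddGroup.eq, QuotientAddGroup.eq]
  constructor
  · intro h
    refine ⟨fun γ hγ => ?_, mem_latticeOf_of_inner e fun γ' hγ' => ?_⟩
    · rw [inner_add_left, inner_neg_left, ← hphase, ← zakState_v κ ν hγ, ← zakState_v κ' ν' hγ, h]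
    · rw [inner_add_right, inner_neg_right, ← hphase, ← zakState_u κ ν hγ', ← zakState_u κ' ν' hγ',
        h]
  · rintro ⟨hκ, hν⟩
    refine ext_of_monomials fun α β => ?_
    rw [zakState_apply, zakState_apply]
    by_cases hα : α ∈ dualLattice (latticeOf e)
    · by_cases hβ : β ∈ latticeOf e
      · rw [zakValue_of_mem hα hβ, zakValue_of_mem hα hβ]
        have h1 := hκ β hβ
        have h2 := hα _ hν
        rw [inner_add_left, inner_neg_left, ← hphase] at h1
        rw [inner_add_right, inner_neg_right, ← hphase] at h2
        rw [h1, h2]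
      · rw [zakValue_of_not_mem_right hβ, zakValue_of_not_mem_right hβ]
    · rw [zakValue_of_not_mem_left hα, zakValue_of_not_mem_left hα]

/-- On `𝕎₀` the values are finite combinations of `zakValue`, hence continuous; since all these
states are contractive, approximating `a` from `𝕎₀` is uniform in the parameters. -/
theorem continuous_zakState (Γ : AddSubgroup (RSpace d)) :
    Continuous fun q : RSpace d × RSpace d => zakState Γ q.1 q.2 := by
  have hcoe (a : WeylAlg d) :
      Continuous fun q : RSpace d × RSpace d => zakState Γ q.1 q.2 (a : WeylCStar d) := by
    induction a using WeylAlg.induction_mono with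
    | h0 => simpa only [Completion.coe_zero, map_zero] using continuous_const
    | hadd f g hf hg =>
      simp only [Completion.coe_add, map_add]
      exact hf.add hg
    | hmono p c =>
      have h1 : WeylAlg.mono p c = c • WeylAlg.mono (p.1, p.2) 1 := by
        rw [WeylAlg.smul_mono, mul_one]
      simp only [h1, Completion.coe_smul, map_smul, ← u_mul_v, zakState_apply]
      exact (continuous_zakValue Γ p.1 p.2).const_smul c
  refine WeakDual.continuous_of_continuous_eval fun a => ?_
  refine continuous_of_uniform_approx_of_continuous fun s hs => ?_
  obtain ⟨ε, hε, hsub⟩ := Metric.mem_uniformity_dist.1 hs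
  obtain ⟨b, hb⟩ := Metric.denseRange_iff.1
    (Completion.denseRange_coe (α := WeylAlg d)) a ε hε
  refine ⟨_, hcoe b, fun q => hsub ?_⟩
  rw [dist_eq_norm, ← map_sub]
  rw [dist_eq_norm] at hb
  exact (norm_zakState_apply_le Γ q.1 q.2 _).trans_lt hb

/-- The parametrization of the pure Zak states. -/
noncomputable def zakMap (q : BrillouinZone (latticeOf e) × LatticeTorus (latticeOf e)) :
    pureZakStates (latticeOf e) :=
  ⟨zakState (latticeOf e) (Quotient.out q.1) (Quotient.out q.2),
    zakState_mem_zakStates _ _ _, zakState_mem_pureStates e _ _⟩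

theorem coe_zakMap_mk (κ ν : RSpace d) :
    (zakMap e ((κ : BrillouinZone (latticeOf e)), (ν : LatticeTorus (latticeOf e))) :
      WeakDual ℂ (WeylCStar d)) = zakState (latticeOf e) κ ν :=
  (zakState_eq_iff e _ _ _ _).2 ⟨Quotient.out_eq _, Quotient.out_eq _⟩

theorem continuous_zakMap : Continuous (zakMap e) := by
  refine Continuous.subtype_mk ?_ _
  -- Both quotient maps are open, so their product is a quotient map and continuity can be tested on
  -- representatives.
  refine ((QuotientAddGroup.isOpenQuotientMap_mk.prodMap
    QuotientAddGroup.isOpenQuotientMap_mk).continuous_comp_iff).1 ?_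
  refine (continuous_zakState (latticeOf e)).congr fun q => ?_
  exact (coe_zakMap_mk e q.1 q.2).symm

theorem bijective_zakMap : Function.Bijective (zakMap e) := by
  constructor
  · rintro ⟨x, y⟩ ⟨x', y'⟩ h
    induction x using QuotientAddGroup.induction_on with | H κ => ?_
    induction y using QuotientAddGroup.induction_on with | H ν => ?_
    induction x' using QuotientAddGroup.induction_on with | H κ' => ?_
    induction y' using QuotientAddGroup.induction_on with | H ν' => ?_
    have h1 := congrArg Subtype.val h
    rw [coe_zakMap_mk, coe_zakMap_mk, zakState_eq_iff] at h1
    exact Prod.ext h1.1 h1.2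
  · rintro ⟨ω, hω⟩
    obtain ⟨κ, ν, h⟩ := exists_eq_zakState e hω
    exact ⟨(κ, ν), Subtype.ext ((coe_zakMap_mk e κ ν).trans h)⟩

end ZakStates

theorem mainTheorem6 (d : ℕ) (e : Module.Basis (Fin d) ℝ (RSpace d)) :
    (∃ Φ : (BrillouinZone (latticeOf e) × LatticeTorus (latticeOf e)) ≃ₜ
        pureZakStates (latticeOf e),
      ∀ κ ν : RSpace d, ∀ ω ∈ WeylCStar.stateSpace d,
        (Φ ((κ : BrillouinZone (latticeOf e)), (ν : LatticeTorus (latticeOf e))) :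
            WeakDual ℂ (WeylCStar d)) = ω ↔
          ∀ α β : RSpace d,
            ω (WeylCStar.u α * WeylCStar.v β) = zakValue (latticeOf e) κ ν α β) ∧
    Nonempty ((BrillouinZone (latticeOf e) × LatticeTorus (latticeOf e)) ≃ₜ
      (Fin (2 * d) → Circle)) := by
  -- The source is a compact product of tori and the weak-`*` dual is Hausdorff, so the inverse is
  -- automatically continuous.
  refine ⟨⟨Continuous.homeoOfEquivCompactToT2 (f := Equiv.ofBijective _ (bijective_zakMap e))
    (continuous_zakMap e), fun κ ν ω _ => ?_⟩,
    nonempty_brillouinZone_prod_latticeTorus_homeomorph e⟩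
  have h : (Continuous.homeoOfEquivCompactToT2 (f := Equiv.ofBijective _ (bijective_zakMap e))
      (continuous_zakMap e) ((κ : BrillouinZone (latticeOf e)), (ν : LatticeTorus (latticeOf e))) :
        WeakDual ℂ (WeylCStar d)) = zakState (latticeOf e) κ ν := coe_zakMap_mk e κ ν
  rw [h]
  constructor
  · rintro rfl α β
    exact zakState_apply _ κ ν α β
  · intro hval
    exact WeylCStar.ext_of_monomials fun α β => by rw [zakState_apply, hval]
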